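/- **Setting.** Let $\mathcal N$ be a network on $m$ modes, given as a finite sequence of $|\mathcal N|$ building blocks. Each block consists of a loss element of transmissivity $\eta\in[0,1]$ on each of two distinct modes $a\ne b$ (every photon passing it survives independently with probability $\eta$), followed by an arbitrary $2\times 2$ unitary linear-optical transformation of the modes $a,b$. Let $\Lambda_{\mathcal N}$ be the resulting channel on the bosonic Fock space of $m$ modes. Let $s$ be the smallest number of beamsplitters traversed by any path from an input mode to an output mode (a path reaching a beamsplitter may leave it through either of its modes), and let $\eta_{\rm eff}=\eta^s$. For $n\le m$ let $\Psi_n$ be the projector onto $|1,\dots,1,0,\dots,0\rangle$ ($n$ ones). Let $\Lambda_{t}$ denote uniform losses of transmissivity $t$ on all modes, let $\mathcal D(\rho;\Lambda)$ be the distribution of the photon-number measurement on $\Lambda(\rho)$, and let $\|P-Q\|=\frac12\sum_x|P(x)-Q(x)|$. Put $$\sigma_{t}=\sum_{l=0}^n\binom nl t^l(1-t)^{n-l}\,\frac1{(2\pi)^n}\int_{[0,2\pi]^n}\big(|v_\varphi\rangle\langle v_\varphi|\big)^{\otimes l}\,d\varphi,\qquad |v_\varphi\rangle=\frac1{\sqrt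 n}\sum_{j=1}^n e^{-i\varphi_j}|j\rangle ,$$ and let $\tilde d(t)$ be the trace distance between $\sigma_t$ and $\Lambda_t(\Psi_n)$. **Model of computation.** A classical algorithm is a fixed program of a probabilistic real RAM (exact real arithmetic $+,-,\times,/,\sqrt{\ }$ and comparisons at unit cost, no rounding, integer addressing, independent uniform random numbers in $[0,1]$ and uniform random phases). Its input consists of $m$, $n$, $\eta$, and the modes and unitary entries of the blocks. It samples a distribution *efficiently* if on every run it halts within a number of steps polynomial in $m+n+|\mathcal N|$ and its output has exactly that distribution. **Statement.** There is one such program with the following properties. 1. For every network $\mathcal N$ and every $\eta\in[0,1]$ there is a network $\tilde{\mathcal N}$ with the same beamsplitters in the same order and with exactly $sm$ fewer loss elements (each of transmissivity $\eta$, possibly at other positions) such that $\Lambda_{\mathcal N}=\Lambda_{\tilde{\mathcal N}}\circ\Lambda_{\eta_{\rm eff}}$. For every $n\le m$ the program efficiently samples $\mathcal D(\sigma_{\eta_{\rm eff}};\Lambda_{\tilde{\mathcal N}})$, and $$\big\|\mathcal D(\Psi_n;\Lambda_{\mathcal N})-\mathcal D(\sigma_{\eta_{\rm eff}};\Lambda_{\tilde{\mathcal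 N}})\big\|\le\tilde d(\eta_{\rm eff}),$$ $$\tilde d(\eta_{\rm eff})=\sum_{l=0}^n\binom nl\eta_{\rm eff}^l(1-\eta_{\rm eff})^{n-l}\Big(1-\frac{n!}{n^l(n-l)!}\Big)\le\frac{\eta_{\rm eff}^2n}{2}+\frac{\eta_{\rm eff}(1-\eta_{\rm eff})}{2}.$$ 2. For every $\eta\in[0,1)$ there is a constant $C>0$, depending only on $\eta$, such that for every $\varepsilon>0$ there is $n_0$ with the following property: for all $n\ge n_0$, all $m\ge n$, and every $m$-mode network $\mathcal N$ with $s\ge C\log n$, the program efficiently samples a distribution within total variation distance $\varepsilon$ of $\mathcal D(\Psi_n;\Lambda_{\mathcal N})$. -/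

import Mathlib

open MeasureTheory
open scoped ComplexConjugate

noncomputable section

namespace LossyOptics

/-! ## Bosonic Fock space with a photon-number cutoff

All transformations below never create photons, so the span of the Fock states with at most `K`
photons is invariant, and operators on it are matrices indexed by occupation-number vectors. -/

/-- Occupation-number vectors of `m` modes with at most `K` photons in total. -/
abbrev Fock (m K : ℕ) : Type := {p : Fin m → ℕ // ∑ i, p i ≤ K}

instance Fock.instFinite (m K : ℕ) : Finite (Fock m K) := by
  refine Finite.of_injective
    (fun p : Fock m K => fun i : Fin m => (⟨p.1 i, ?_⟩ : Fin (K + 1))) ?_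
  · exact Nat.lt_succ_of_le
      ((Finset.single_le_sum (fun j _ => Nat.zero_le (p.1 j)) (Finset.mem_univ i)).trans p.2)
  · intro p q h
    apply Subtype.ext
    funext i
    exact congrArg Fin.val (congrFun h i)

instance Fock.instFintype (m K : ℕ) : Fintype (Fock m K) := Fintype.ofFinite _

/-- Operators (in particular density operators) on the Fock space, in the occupation-number
basis. -/
abbrev Op (m K : ℕ) : Type := Matrix (Fock m K) (Fock m K) ℂ

/-- `∏ i, p_i!`. -/
def occFactorial {m : ℕ} (p : Fin m → ℕ) : ℕ := ∏ i, (p i).factorial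

/-- The amplitude `⟨p| f(a₁†, …, a_m†) |vacuum⟩` of a polynomial `f` in the creation operators:
the variable `X i` stands for `a_i†`, and `∏ i, (a_i†)^(p_i) |vacuum⟩ = √(∏ i, p_i!) |p⟩`. -/
def amplitude {m K : ℕ} (f : MvPolynomial (Fin m) ℂ) (p : Fock m K) : ℂ :=
  (Real.sqrt (occFactorial p.1) : ℂ) * f.coeff (Finsupp.equivFunOnFinite.symm p.1)

/-- The creation operator `∑ j, v_j a_j†` of a single-photon state `v`. -/
def creation {m : ℕ} (v : Fin m → ℂ) : MvPolynomial (Fin m) ℂ :=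
  ∑ j, MvPolynomial.C (v j) * MvPolynomial.X j

/-- The operator induced on Fock space by a single-particle matrix `U`: it substitutes
`a_i† ↦ ∑ j, U_{ji} a_j†` in `|q⟩ = ∏ i, (a_i†)^(q_i) / √(q_i!) |vacuum⟩`. -/
def secondQuant {m : ℕ} (K : ℕ) (U : Matrix (Fin m) (Fin m) ℂ) : Op m K :=
  fun p q => amplitude (∏ i, creation (fun j => U j i) ^ (q.1 i)) p /
    (Real.sqrt (occFactorial q.1) : ℂ)

/-! ## Loss elements, beamsplitters and networks -/

/-- Kraus operator of a loss element of transmissivity `η` on mode `i`, for the event that exactly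
`k` photons are lost:
`|q⟩ ↦ √(binom(q_i, k) η^(q_i - k) (1 - η)^k) |q - k e_i⟩`. -/
def lossKraus {m : ℕ} (K : ℕ) (η : ℝ) (i : Fin m) (k : ℕ) : Op m K :=
  fun p q => if q.1 = Function.update p.1 i (p.1 i + k)
    then (Real.sqrt (((q.1 i).choose k : ℝ) * η ^ (p.1 i) * (1 - η) ^ k) : ℂ) else 0

/-- The channel of a loss element: each photon in mode `i` survives with probability `η`. -/
def lossChannel {m : ℕ} (K : ℕ) (η : ℝ) (i : Fin m) (ρ : Op m K) : Op m K :=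
  ∑ k ∈ Finset.range (K + 1),
    lossKraus K η i k * ρ * (lossKraus K η i k).conjTranspose

/-- A lossless two-mode linear-optical element: an arbitrary `2 × 2` unitary on two distinct
modes. -/
structure Beamsplitter (m : ℕ) where
  fst : Fin m
  snd : Fin m
  ne : fst ≠ snd
  u : Matrix.unitaryGroup (Fin 2) ℂ

/-- The single-particle `m × m` matrix of a two-mode element. -/
def Beamsplitter.matrix {m : ℕ} (g : Beamsplitter m) : Matrix (Fin m) (Fin m) ℂ :=
  fun i j =>
    if i = g.fst then
      if j = g.fst then g.u.1 0 0 else if j = g.snd then g.u.1 0 1 else 0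
    else if i = g.snd then
      if j = g.fst then g.u.1 1 0 else if j = g.snd then g.u.1 1 1 else 0
    else if i = j then 1 else 0

/-- The elements of a general lossy network: single-mode loss elements and beamsplitters. -/
inductive Element (m : ℕ) where
  | loss (i : Fin m)
  | bs (g : Beamsplitter m)

/-- The channel of an element, when every loss element has transmissivity `η`. -/
def Element.channel {m : ℕ} (K : ℕ) (η : ℝ) : Element m → Op m K → Op m K
  | .loss i, ρ => lossChannel K η i ρ
  | .bs g, ρ => secondQuant K g.matrix * ρ * (secondQuant K g.matrix).conjTranspose

/-- The channel of a list of elements; the head of the list acts first. -/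
def channel {m : ℕ} (K : ℕ) (η : ℝ) (L : List (Element m)) (ρ : Op m K) : Op m K :=
  L.foldl (fun τ e => e.channel K η τ) ρ

/-- Uniform losses of transmissivity `η`: one loss element on every mode. -/
def uniformLoss {m : ℕ} (K : ℕ) (η : ℝ) (ρ : Op m K) : Op m K :=
  channel K η ((List.finRange m).map Element.loss) ρ

/-- The beamsplitters of a list of elements, in order. -/
def beamsplitters {m : ℕ} (L : List (Element m)) : List (Beamsplitter m) :=
  L.filterMap (fun e => match e with
    | .loss _ => none
    | .bs g => some g)

/-- The number of loss elements of a list of elements. -/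
def lossCount {m : ℕ} (L : List (Element m)) : ℕ :=
  L.countP (fun e => match e with
    | .loss _ => true
    | .bs _ => false)

/-- A network of lossy two-mode building blocks on `m` modes, of arbitrary geometry, in a
chronological order of its blocks. -/
abbrev Network (m : ℕ) : Type := List (Beamsplitter m)

/-- Each block of a network is a beamsplitter with a loss element in both of its input arms. -/
def Network.elements {m : ℕ} (N : Network m) : List (Element m) :=
  N.flatMap (fun g => [Element.loss g.fst, Element.loss g.snd, Element.bs g])

/-- `PathLength N i j k`: some path from input mode `i` to output mode `j` traverses exactly `k`
beamsplitters. On reaching a beamsplitter, a path may leave it through either of its two modes. -/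
inductive PathLength {m : ℕ} : Network m → Fin m → Fin m → ℕ → Prop
  | nil (i : Fin m) : PathLength [] i i 0
  | hit {g : Beamsplitter m} {N : Network m} {i i' j : Fin m} {k : ℕ}
      (hi : i = g.fst ∨ i = g.snd) (hi' : i' = g.fst ∨ i' = g.snd)
      (h : PathLength N i' j k) : PathLength (g :: N) i j (k + 1)
  | miss {g : Beamsplitter m} {N : Network m} {i j : Fin m} {k : ℕ}
      (h₁ : i ≠ g.fst) (h₂ : i ≠ g.snd)
      (h : PathLength N i j k) : PathLength (g :: N) i j k

/-- The smallest number of beamsplitters traversed by a path from an input to an output. -/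
def minDepth {m : ℕ} (N : Network m) : ℕ := sInf {k | ∃ i j, PathLength N i j k}

/-! ## States, measurement and distances -/

/-- The occupation numbers `(1, …, 1, 0, …, 0)` with `n` ones. -/
def standardOcc (m n : ℕ) : Fock m n :=
  ⟨fun i => if i.1 < n then 1 else 0, by
    rw [Finset.sum_boole, Nat.cast_id, ← Finset.card_map Fin.valEmbedding]
    refine (Finset.card_le_card (t := Finset.range n) ?_).trans_eq (Finset.card_range n)
    intro a ha
    simp only [Finset.mem_map, Finset.mem_filter, Finset.mem_univ, true_and] at ha
    obtain ⟨i, hi, rfl⟩ := ha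
    exact Finset.mem_range.2 hi⟩

/-- The projector onto the standard input state `|1, …, 1, 0, …, 0⟩`. -/
def inputState (m n : ℕ) : Op m n := Matrix.single (standardOcc m n) (standardOcc m n) 1

/-- The vector `|v⟩^{⊗ l} = (∑ j, v_j a_j†)^l / √(l!) |vacuum⟩`. -/
def productVec {m : ℕ} (K : ℕ) (v : Fin m → ℂ) (l : ℕ) : Fock m K → ℂ :=
  fun p => amplitude (creation v ^ l) p / (Real.sqrt l.factorial : ℂ)

/-- The single-photon state `(1/√n) ∑_{i < n} exp(-i φ_i) |i⟩`. -/
def phaseState (m n : ℕ) (φ : Fin n → ℝ) : Fin m → ℂ :=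
  fun i => if h : i.1 < n then
    Complex.exp (-(Complex.I * (φ ⟨i.1, h⟩ : ℂ))) / (Real.sqrt n : ℂ) else 0

/-- The particle-separable `l`-photon state
`(2π)^{-n} ∫_{[0,2π]^n} (|v_φ⟩⟨v_φ|)^{⊗ l} dφ`, where `v_φ = phaseState m n φ`. -/
def sepState (m n l : ℕ) : Op m n :=
  fun p q => (((2 * Real.pi) ^ n : ℝ) : ℂ)⁻¹ *
    ∫ φ in Set.Icc (0 : Fin n → ℝ) (fun _ => 2 * Real.pi),
      productVec n (phaseState m n φ) l p * conj (productVec n (phaseState m n φ) l q)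

/-- The mixture `∑_l binom(n, l) η^l (1 - η)^(n - l) sepState m n l`. -/
def sepMixture (m n : ℕ) (η : ℝ) : Op m n :=
  ∑ l ∈ Finset.range (n + 1),
    (((n.choose l : ℝ) * η ^ l * (1 - η) ^ (n - l) : ℝ) : ℂ) • sepState m n l

/-- The distribution of the photon-number measurement on the state `ρ`. -/
def outputDist {m K : ℕ} (ρ : Op m K) : Fock m K → ℝ := fun p => (ρ p p).re

/-- Total variation distance. -/
def tvDist {α : Type*} [Fintype α] (P Q : α → ℝ) : ℝ := (1 / 2) * ∑ x, |P x - Q x|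

/-- Trace distance `(1/2) tr √((ρ - σ)† (ρ - σ))`. -/
def traceDist {α : Type*} [Fintype α] [DecidableEq α] (ρ σ : Matrix α α ℂ) : ℝ :=
  (1 / 2) * ∑ i, Real.sqrt
    ((Matrix.isHermitian_conjTranspose_mul_self (ρ - σ)).eigenvalues i)

/-- `d̃(η)`: the trace distance between the separable mixture and the standard input state after
uniform losses of transmissivity `η`. -/
def sepDist (m n : ℕ) (η : ℝ) : ℝ :=
  traceDist (sepMixture m n η) (uniformLoss n η (inputState m n))

/-! ## A probabilistic real RAM

Programs of a fixed finite text, with natural-number arrays (used for addressing and output) and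
real arrays, exact arithmetic at unit cost, and independent random numbers. There is no
rounding (floor) operation. -/

/-- Expressions of natural-number type. `get a e` is the cell with index `e` of the array `a`. -/
inductive NExp where
  | const (k : ℕ)
  | get (a : ℕ) (e : NExp)
  | add (e f : NExp)
  | sub (e f : NExp)

/-- Expressions of real type. -/
inductive RExp where
  | const (k : ℤ)
  | get (a : ℕ) (e : NExp)
  | ofNat (e : NExp)
  | add (x y : RExp)
  | sub (x y : RExp)
  | mul (x y : RExp)
  | div (x y : RExp)
  | sqrt (x : RExp)

/-- Tests. -/
inductive Test where
  | ltN (e f : NExp)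
  | ltR (x y : RExp)

/-- Programs. `uniform a e` stores a uniformly random number of `[0, 1]`, and `phase a e b f`
stores the cosine and the sine of a uniformly random angle. -/
inductive Cmd where
  | skip
  | setN (a : ℕ) (e : NExp) (f : NExp)
  | setR (a : ℕ) (e : NExp) (x : RExp)
  | uniform (a : ℕ) (e : NExp)
  | phase (a : ℕ) (e : NExp) (b : ℕ) (f : NExp)
  | seq (c d : Cmd)
  | ite (b : Test) (c d : Cmd)
  | loop (b : Test) (c : Cmd)

/-- Memory contents: the arrays, and the number of random numbers consumed so far. -/
structure Store where
  nat : ℕ → ℕ → ℕ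
  real : ℕ → ℕ → ℝ
  used : ℕ

def NExp.eval (st : Store) : NExp → ℕ
  | .const k => k
  | .get a e => st.nat a (e.eval st)
  | .add e f => e.eval st + f.eval st
  | .sub e f => e.eval st - f.eval st

def RExp.eval (st : Store) : RExp → ℝ
  | .const k => k
  | .get a e => st.real a (e.eval st)
  | .ofNat e => (e.eval st : ℝ)
  | .add x y => x.eval st + y.eval st
  | .sub x y => x.eval st - y.eval st
  | .mul x y => x.eval st * y.eval st
  | .div x y => x.eval st / y.eval st
  | .sqrt x => Real.sqrt (x.eval st)

def Test.holds (st : Store) : Test → Prop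
  | .ltN e f => e.eval st < f.eval st
  | .ltR x y => x.eval st < y.eval st

/-- Number of operations in an expression. -/
def NExp.cost : NExp → ℕ
  | .const _ => 1
  | .get _ e => e.cost + 1
  | .add e f => e.cost + f.cost + 1
  | .sub e f => e.cost + f.cost + 1

/-- Number of operations in an expression. -/
def RExp.cost : RExp → ℕ
  | .const _ => 1
  | .get _ e => e.cost + 1
  | .ofNat e => e.cost + 1
  | .add x y => x.cost + y.cost + 1
  | .sub x y => x.cost + y.cost + 1
  | .mul x y => x.cost + y.cost + 1
  | .div x y => x.cost + y.cost + 1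
  | .sqrt x => x.cost + 1

/-- Number of operations in a test. -/
def Test.cost : Test → ℕ
  | .ltN e f => e.cost + f.cost + 1
  | .ltR x y => x.cost + y.cost + 1

def Store.writeN (st : Store) (a k v : ℕ) : Store :=
  { st with nat := Function.update st.nat a (Function.update (st.nat a) k v) }

def Store.writeR (st : Store) (a k : ℕ) (v : ℝ) : Store :=
  { st with real := Function.update st.real a (Function.update (st.real a) k v) }

def Store.tick (st : Store) : Store := { st with used := st.used + 1 }

/-- `Exec ω c st t st'`: with the random numbers `ω`, the program `c` started in `st` halts in `st'`
after exactly `t` steps. -/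
inductive Exec (ω : ℕ → unitInterval) : Cmd → Store → ℕ → Store → Prop
  | skip (st : Store) : Exec ω .skip st 1 st
  | setN (st : Store) (a : ℕ) (e f : NExp) :
      Exec ω (.setN a e f) st (e.cost + f.cost + 1) (st.writeN a (e.eval st) (f.eval st))
  | setR (st : Store) (a : ℕ) (e : NExp) (x : RExp) :
      Exec ω (.setR a e x) st (e.cost + x.cost + 1) (st.writeR a (e.eval st) (x.eval st))
  | uniform (st : Store) (a : ℕ) (e : NExp) :
      Exec ω (.uniform a e) st (e.cost + 1)
        (st.writeR a (e.eval st) (ω st.used : ℝ)).tick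
  | phase (st : Store) (a : ℕ) (e : NExp) (b : ℕ) (f : NExp) :
      Exec ω (.phase a e b f) st (e.cost + f.cost + 1)
        (((st.writeR a (e.eval st) (Real.cos (2 * Real.pi * (ω st.used : ℝ)))).writeR b
          (f.eval st) (Real.sin (2 * Real.pi * (ω st.used : ℝ))))).tick
  | seq {c d : Cmd} {st st' st'' : Store} {t t' : ℕ} (h : Exec ω c st t st')
      (h' : Exec ω d st' t' st'') : Exec ω (.seq c d) st (t + t') st''
  | iteTrue {b : Test} {c d : Cmd} {st st' : Store} {t : ℕ} (hb : b.holds st)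
      (h : Exec ω c st t st') : Exec ω (.ite b c d) st (b.cost + t) st'
  | iteFalse {b : Test} {c d : Cmd} {st st' : Store} {t : ℕ} (hb : ¬ b.holds st)
      (h : Exec ω d st t st') : Exec ω (.ite b c d) st (b.cost + t) st'
  | loopDone {b : Test} {c : Cmd} {st : Store} (hb : ¬ b.holds st) :
      Exec ω (.loop b c) st b.cost st
  | loopStep {b : Test} {c : Cmd} {st st' st'' : Store} {t t' : ℕ} (hb : b.holds st)
      (h : Exec ω c st t st') (h' : Exec ω (.loop b c) st' t' st'') :
      Exec ω (.loop b c) st (b.cost + t + t') st''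

/-- The random numbers determine the run: its final memory and its number of steps. -/
theorem Exec.det {ω : ℕ → unitInterval} {c : Cmd} {st st₁ st₂ : Store} {t₁ t₂ : ℕ}
    (h₁ : Exec ω c st t₁ st₁) (h₂ : Exec ω c st t₂ st₂) : t₁ = t₂ ∧ st₁ = st₂ := by
  induction h₁ generalizing t₂ st₂ with
  | skip | setN | setR | uniform | phase => cases h₂; exact ⟨rfl, rfl⟩
  | seq _ _ ih ih' =>
    cases h₂ with
    | seq k k' =>
      obtain ⟨rfl, rfl⟩ := ih k
      obtain ⟨rfl, rfl⟩ := ih' k'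
      exact ⟨rfl, rfl⟩
  | iteTrue hb _ ih =>
    cases h₂ with
    | iteTrue _ k => obtain ⟨rfl, rfl⟩ := ih k; exact ⟨rfl, rfl⟩
    | iteFalse hb' => exact absurd hb hb'
  | iteFalse hb _ ih =>
    cases h₂ with
    | iteFalse _ k => obtain ⟨rfl, rfl⟩ := ih k; exact ⟨rfl, rfl⟩
    | iteTrue hb' => exact absurd hb' hb
  | loopDone hb =>
    cases h₂ with
    | loopDone => exact ⟨rfl, rfl⟩
    | loopStep hb' => exact absurd hb' hb
  | loopStep hb _ _ ih ih' =>
    cases h₂ with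
    | loopDone hb' => exact absurd hb hb'
    | loopStep _ k k' =>
      obtain ⟨rfl, rfl⟩ := ih k
      obtain ⟨rfl, rfl⟩ := ih' k'
      exact ⟨rfl, rfl⟩

/-- Independent uniform random numbers. -/
def tapeLaw : Measure (ℕ → unitInterval) :=
  Measure.infinitePi (fun _ : ℕ => (volume : Measure unitInterval))

/-- The memory at the start. Natural-number array `0` holds `m`, `n` and the number of
blocks, arrays `1` and `2` hold the two modes of each block; real array `0` holds `η`, and
arrays `1, …, 8` hold the real and imaginary parts of the entries of each `2 × 2` unitary. All other
cells are `0`. -/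
def inputStore {m : ℕ} (n : ℕ) (η : ℝ) (N : Network m) : Store where
  nat := fun a k =>
    match a with
    | 0 => if k = 0 then m else if k = 1 then n else if k = 2 then N.length else 0
    | 1 => (N[k]?).elim 0 (fun g => g.fst.1)
    | 2 => (N[k]?).elim 0 (fun g => g.snd.1)
    | _ => 0
  real := fun a k =>
    match a with
    | 0 => if k = 0 then η else 0
    | 1 => (N[k]?).elim 0 (fun g => (g.u.1 0 0).re)
    | 2 => (N[k]?).elim 0 (fun g => (g.u.1 0 0).im)
    | 3 => (N[k]?).elim 0 (fun g => (g.u.1 0 1).re)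
    | 4 => (N[k]?).elim 0 (fun g => (g.u.1 0 1).im)
    | 5 => (N[k]?).elim 0 (fun g => (g.u.1 1 0).re)
    | 6 => (N[k]?).elim 0 (fun g => (g.u.1 1 0).im)
    | 7 => (N[k]?).elim 0 (fun g => (g.u.1 1 1).re)
    | 8 => (N[k]?).elim 0 (fun g => (g.u.1 1 1).im)
    | _ => 0
  used := 0

/-- Started in `st`, the program `c` always halts within `T` steps, and the occupation numbers that
it leaves in cells `0, …, m - 1` of the natural-number array `3` are distributed exactly as `Q`. -/
def SamplesWithin {m K : ℕ} (c : Cmd) (st : Store) (T : ℕ) (Q : Fock m K → ℝ) : Prop :=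
  ∃ out : (ℕ → unitInterval) → Fock m K,
    (∀ ω, ∃ t ≤ T, ∃ st', Exec ω c st t st' ∧ ∀ j : Fin m, st'.nat 3 j.1 = (out ω).1 j) ∧
    ∀ p, MeasurableSet (out ⁻¹' {p}) ∧ tapeLaw.real (out ⁻¹' {p}) = Q p

end LossyOptics

end

open LossyOptics

/-!
Every linear-optical element acts on the operators `|coherent v⟩⟨coherent w|`, with part of the
amplitude leaked, through a single-particle matrix acting on `v` and `w`. These operators span the
operators on Fock space, so a network's channel is determined by the product of the matrices of its
elements. Losses of equal transmissivity on both modes of a beamsplitter commute with its matrix;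
pushing them towards the input, every mode receives at least as many losses as the smallest number
of beamsplitters that a path from it must cross, which factors out `η ^ s` on all modes.

Uniform losses turn `|1, …, 1, 0, …⟩` into a binomial mixture of its marginals and turn a
phase-averaged product state into the same mixture of its own powers. The phase average makes the
latter diagonal in the occupation numbers with multinomial weights, so the two conditional
`l`-particle states differ only by the weight of collisions, which gives
`1 - n! / (n ^ l (n - l)!)`. Data processing transfers this distance to the measured distributions.

A network maps a product of identical single-particle states to such a product, with part of each
particle lost. Sampling it therefore amounts to drawing the phases, propagating one amplitude vector
through the network, and placing the `n` photons independently, which yields multinomial counts.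
-/

noncomputable section

namespace LossyOptics

open scoped Matrix

theorem ofReal_sqrt_mul_self {x : ℝ} (hx : 0 ≤ x) : (Real.sqrt x : ℂ) * (Real.sqrt x : ℂ) = x := by
  rw [← Complex.ofReal_mul, Real.mul_self_sqrt hx]

theorem ofReal_sqrt_ne_zero {x : ℝ} (hx : 0 < x) : (Real.sqrt x : ℂ) ≠ 0 :=
  Complex.ofReal_ne_zero.2 (Real.sqrt_pos.2 hx).ne'

/-! ## Coherent vectors -/

section CoherentVectors

variable {m K l : ℕ}

theorem occFactorial_pos (p : Fin m → ℕ) : 0 < occFactorial p :=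
  Finset.prod_pos fun i _ => Nat.factorial_pos (p i)

theorem sqrt_occFactorial_ne_zero (p : Fin m → ℕ) : (Real.sqrt (occFactorial p) : ℂ) ≠ 0 :=
  ofReal_sqrt_ne_zero (Nat.cast_pos.2 (occFactorial_pos p))

theorem sqrt_occFactorial_mul_self (p : Fin m → ℕ) :
    (Real.sqrt (occFactorial p) : ℂ) * (Real.sqrt (occFactorial p) : ℂ) = occFactorial p := by
  simpa using ofReal_sqrt_mul_self (Nat.cast_nonneg (occFactorial p))

/-- The amplitude `∏ i, v_i ^ p_i / √(p_i!)` at `|p⟩` of the unnormalized coherent state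
`exp (∑ i, v_i a_i†) |vacuum⟩`. -/
def coherentAmp (v : Fin m → ℂ) (p : Fin m → ℕ) : ℂ :=
  (∏ i, v i ^ p i) / (Real.sqrt (occFactorial p) : ℂ)

/-- The `l`-photon component `(∑ i, v_i a_i†) ^ l / l! |vacuum⟩` of the unnormalized coherent
state. Its norm is not fixed, so that it is polynomial in `v`. -/
def coherent (K l : ℕ) (v : Fin m → ℂ) : Fock m K → ℂ :=
  fun p => if ∑ i, p.1 i = l then coherentAmp v p.1 else 0

theorem coherentAmp_mul_coherentAmp (v w : Fin m → ℂ) (p : Fin m → ℕ) :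
    coherentAmp v p * coherentAmp w p = (∏ i, (v i * w i) ^ p i) / occFactorial p := by
  rw [coherentAmp, coherentAmp, div_mul_div_comm, sqrt_occFactorial_mul_self,
    ← Finset.prod_mul_distrib]
  simp only [mul_pow]

theorem conj_coherentAmp (v : Fin m → ℂ) (p : Fin m → ℕ) :
    conj (coherentAmp v p) = coherentAmp (star v) p := by
  simp [coherentAmp]

theorem sum_fock_ite_eq_sum_piAntidiag (hl : l ≤ K) {M : Type*} [AddCommMonoid M]
    (f : (Fin m → ℕ) → M) :
    ∑ q : Fock m K, (if ∑ i, q.1 i = l then f q.1 else 0) =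
      ∑ q ∈ Finset.piAntidiag Finset.univ l, f q := by
  rw [← Finset.sum_filter]
  refine Finset.sum_bij (fun q _ => q.1) (fun q hq => by simpa using hq)
    (fun q _ q' _ h => Subtype.ext h) (fun q hq => ?_) (fun q _ => rfl)
  have hq' : ∑ i, q i = l := by simpa using hq
  exact ⟨⟨q, hq'.le.trans hl⟩, by simpa using hq', rfl⟩

theorem multinomial_univ_eq_div (q : Fin m → ℕ) :
    (Nat.multinomial Finset.univ q : ℂ) = (∑ i, q i).factorial / occFactorial q := by
  rw [eq_div_iff (Nat.cast_ne_zero.2 (occFactorial_pos q).ne'), mul_comm]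
  exact_mod_cast Nat.multinomial_spec Finset.univ q

theorem sum_pow_eq_sum_piAntidiag_smul {R : Type*} [CommRing R] [Algebra ℂ R] (f : Fin m → R)
    (l : ℕ) :
    (∑ i, f i) ^ l = ∑ q ∈ Finset.piAntidiag Finset.univ l,
      (l.factorial / occFactorial q : ℂ) • ∏ i, f i ^ q i := by
  rw [Finset.sum_pow_eq_sum_piAntidiag]
  refine Finset.sum_congr rfl fun q hq => ?_
  have hq' : ∑ i, q i = l := by simpa using hq
  rw [← hq', ← multinomial_univ_eq_div q, Algebra.smul_def, map_natCast]

theorem sum_pow_eq_sum_fock {R : Type*} [CommRing R] [Algebra ℂ R] (f : Fin m → R) (hl : l ≤ K) :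
    (∑ i, f i) ^ l = ∑ q : Fock m K, if ∑ i, q.1 i = l then
      (l.factorial / occFactorial q.1 : ℂ) • ∏ i, f i ^ q.1 i else 0 := by
  rw [sum_pow_eq_sum_piAntidiag_smul, sum_fock_ite_eq_sum_piAntidiag hl
    (fun q => (l.factorial / occFactorial q : ℂ) • ∏ i, f i ^ q i)]

theorem coeff_creation_pow (v : Fin m → ℂ) (l : ℕ) (p : Fin m → ℕ) :
    (creation v ^ l).coeff (Finsupp.equivFunOnFinite.symm p) =
      if ∑ i, p i = l then (l.factorial / occFactorial p : ℂ) * ∏ i, v i ^ p i else 0 := by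
  have prod_eq_monomial (q : Fin m → ℕ) :
      ∏ i, (MvPolynomial.C (v i) * MvPolynomial.X i) ^ q i =
        MvPolynomial.monomial (Finsupp.equivFunOnFinite.symm q) (∏ i, v i ^ q i) := by
    rw [MvPolynomial.monomial_eq, Finsupp.prod_fintype _ _ (by simp)]
    simp [mul_pow, Finset.prod_mul_distrib]
  simp only [creation, sum_pow_eq_sum_piAntidiag_smul, prod_eq_monomial, MvPolynomial.coeff_sum,
    MvPolynomial.coeff_smul, MvPolynomial.coeff_monomial, EmbeddingLike.apply_eq_iff_eq,
    smul_eq_mul, mul_ite, mul_zero, Finset.sum_ite_eq', Finset.mem_piAntidiag, Finset.mem_univ,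
    implies_true, and_true]

theorem amplitude_sum {ι : Type*} (s : Finset ι) (f : ι → MvPolynomial (Fin m) ℂ) (p : Fock m K) :
    amplitude (∑ i ∈ s, f i) p = ∑ i ∈ s, amplitude (f i) p := by
  simp only [amplitude, MvPolynomial.coeff_sum, Finset.mul_sum]

theorem amplitude_smul (c : ℂ) (f : MvPolynomial (Fin m) ℂ) (p : Fock m K) :
    amplitude (c • f) p = c * amplitude f p := by
  rw [amplitude, MvPolynomial.coeff_smul, smul_eq_mul, mul_left_comm, amplitude]

theorem amplitude_creation_pow (v : Fin m → ℂ) (l : ℕ) (p : Fock m K) :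
    amplitude (creation v ^ l) p = l.factorial * coherent K l v p := by
  rw [amplitude, coherent, coeff_creation_pow]
  split_ifs
  · rw [coherentAmp, ← sqrt_occFactorial_mul_self]
    field_simp [sqrt_occFactorial_ne_zero p.1]
  · simp

theorem productVec_eq_smul_coherent (v : Fin m → ℂ) (l : ℕ) :
    productVec K v l = (Real.sqrt l.factorial : ℂ) • coherent K l v := by
  funext p
  have hl : (0 : ℝ) < l.factorial := Nat.cast_pos.2 l.factorial_pos
  rw [productVec, amplitude_creation_pow, Pi.smul_apply, smul_eq_mul,
    div_eq_iff (ofReal_sqrt_ne_zero hl), mul_right_comm, ofReal_sqrt_mul_self hl.le,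
    Complex.ofReal_natCast]

theorem coherent_smul (c : ℂ) (v : Fin m → ℂ) : coherent K l (c • v) = c ^ l • coherent K l v := by
  funext p
  simp only [coherent, coherentAmp, Pi.smul_apply, smul_eq_mul, mul_pow, Finset.prod_mul_distrib,
    Finset.prod_pow_eq_pow_sum, mul_ite, mul_zero]
  split_ifs with h
  · rw [h, mul_div_assoc]
  · rfl

theorem coherent_dotProduct_star_coherent (hl : l ≤ K) (v w : Fin m → ℂ) :
    coherent K l v ⬝ᵥ star (coherent K l w) = (v ⬝ᵥ star w) ^ l / l.factorial := by
  have hl0 : (l.factorial : ℂ) ≠ 0 := Nat.cast_ne_zero.2 l.factorial_ne_zero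
  simp only [dotProduct]
  rw [sum_pow_eq_sum_fock _ hl, Finset.sum_div]
  refine Finset.sum_congr rfl fun p _ => ?_
  rw [Pi.star_apply, coherent, coherent]
  split_ifs
  · rw [RCLike.star_def, conj_coherentAmp, coherentAmp_mul_coherentAmp, smul_eq_mul]
    field_simp
  · simp

theorem creation_mulVec (U : Matrix (Fin m) (Fin m) ℂ) (v : Fin m → ℂ) :
    creation (U *ᵥ v) = ∑ i, v i • creation (fun j => U j i) := by
  simp only [creation, Matrix.mulVec, dotProduct, map_sum, Finset.sum_mul, Finset.smul_sum,
    MvPolynomial.smul_eq_C_mul, map_mul]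
  rw [Finset.sum_comm]
  exact Finset.sum_congr rfl fun i _ => Finset.sum_congr rfl fun j _ => by ring

theorem secondQuant_mulVec_coherent (hl : l ≤ K) (U : Matrix (Fin m) (Fin m) ℂ)
    (v : Fin m → ℂ) : secondQuant K U *ᵥ coherent K l v = coherent K l (U *ᵥ v) := by
  funext p
  apply mul_left_cancel₀ (Nat.cast_ne_zero.2 l.factorial_ne_zero : (l.factorial : ℂ) ≠ 0)
  rw [← amplitude_creation_pow, creation_mulVec, sum_pow_eq_sum_fock _ hl, amplitude_sum,
    Matrix.mulVec, dotProduct, Finset.mul_sum]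
  refine Finset.sum_congr rfl fun q _ => ?_
  rw [coherent]
  split_ifs
  · simp only [smul_pow]
    rw [Finset.prod_smul, amplitude_smul, amplitude_smul, secondQuant, coherentAmp,
      ← sqrt_occFactorial_mul_self]
    field_simp [sqrt_occFactorial_ne_zero q.1]
  · simp [amplitude]

theorem eq_zero_of_forall_sum_mul_prod_pow_eq_zero {c : Fock m K → ℂ}
    (h : ∀ v : Fin m → ℂ, ∑ p, c p * ∏ i, v i ^ p.1 i = 0) : c = 0 := by
  let f : MvPolynomial (Fin m) ℂ :=
    ∑ p : Fock m K, MvPolynomial.monomial (Finsupp.equivFunOnFinite.symm p.1) (c p)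
  have coeff_f (p : Fock m K) : f.coeff (Finsupp.equivFunOnFinite.symm p.1) = c p := by
    simp [f, MvPolynomial.coeff_sum, MvPolynomial.coeff_monomial, Subtype.val_inj]
  have eval_f (v : Fin m → ℂ) : MvPolynomial.eval v f = 0 := by
    rw [← h v]
    simp [f, MvPolynomial.eval_monomial, Finsupp.prod_fintype]
  have hf : f = 0 := MvPolynomial.funext fun v => by rw [eval_f, map_zero]
  funext p
  rw [← coeff_f, hf, MvPolynomial.coeff_zero, Pi.zero_apply]

/-- The coherent vectors with a definite number of photons. -/
def coherentSet (m K : ℕ) : Set (Fock m K → ℂ) := {x | ∃ l ≤ K, ∃ v : Fin m → ℂ, x = coherent K l v}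

theorem sum_range_coherent (v : Fin m → ℂ) (p : Fock m K) :
    ∑ l ∈ Finset.range (K + 1), coherent K l v p = coherentAmp v p.1 := by
  simp [coherent, p.2]

theorem span_coherentSet : Submodule.span ℂ (coherentSet m K) = ⊤ := by
  -- A functional killing all coherent vectors gives a polynomial in `v` that vanishes everywhere.
  by_contra hne
  obtain ⟨f, hf0, hf⟩ := Submodule.exists_le_ker_of_lt_top _ (lt_top_iff_ne_top.2 hne)
  have hf_coherent (l : ℕ) (hl : l ≤ K) (v : Fin m → ℂ) : f (coherent K l v) = 0 :=
    hf (Submodule.subset_span ⟨l, hl, v, rfl⟩)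
  have hf_basis (p : Fock m K) : f (Pi.single p 1) = 0 := by
    have h : (fun p : Fock m K => f (Pi.single p 1) / (Real.sqrt (occFactorial p.1) : ℂ)) = 0 := by
      refine eq_zero_of_forall_sum_mul_prod_pow_eq_zero fun v => ?_
      calc ∑ p : Fock m K, f (Pi.single p 1) / (Real.sqrt (occFactorial p.1) : ℂ) *
            ∏ i, v i ^ p.1 i
          = ∑ p : Fock m K, coherentAmp v p.1 * f (Pi.single p 1) :=
            Finset.sum_congr rfl fun p _ => by rw [coherentAmp]; ring
        _ = f (fun p => coherentAmp v p.1) := by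
            have single_eq_ite (p : Fock m K) :
                (Pi.single p 1 : Fock m K → ℂ) = fun q => if p = q then 1 else 0 :=
              funext fun q => by rw [Pi.single_apply]; simp only [eq_comm]
            rw [LinearMap.pi_apply_eq_sum_univ f (fun p => coherentAmp v p.1)]
            simp only [single_eq_ite, smul_eq_mul]
        _ = ∑ l ∈ Finset.range (K + 1), f (coherent K l v) := by
            rw [← map_sum]
            congr 1
            funext p
            rw [Finset.sum_apply, sum_range_coherent]
        _ = 0 := Finset.sum_eq_zero fun l hl =>
            hf_coherent l (Nat.lt_succ_iff.1 (Finset.mem_range.1 hl)) v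
    exact (div_eq_zero_iff.1 (congrFun h p)).resolve_right (sqrt_occFactorial_ne_zero p.1)
  exact hf0 (LinearMap.pi_ext' fun p => LinearMap.ext_ring (by simpa using hf_basis p))

end CoherentVectors

/-! ## Coherent operators -/

section CoherentOperators

variable {m K a b l : ℕ} {η : ℝ}

/-- `∑ k, z ^ k / k! • |coherent (a - k) v⟩⟨coherent (b - k) w|`: the operator left when pairs of
photons, one from the ket and one from the bra, leak out of `|coherent a v⟩⟨coherent b w|`. Linear
optics preserves the form of these operators, and losses only move weight from `v` and `w` to the
leaked amplitude `z`. -/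
def coherentOp (K a b : ℕ) (z : ℂ) (v w : Fin m → ℂ) : Op m K :=
  ∑ k ∈ Finset.range (min a b + 1), (z ^ k / k.factorial) •
    Matrix.vecMulVec (coherent K (a - k) v) (star (coherent K (b - k) w))

theorem coherentOp_zero (v w : Fin m → ℂ) :
    coherentOp K a b 0 v w = Matrix.vecMulVec (coherent K a v) (star (coherent K b w)) := by
  rw [coherentOp, Finset.sum_range_succ', Finset.sum_eq_zero]
  · simp
  · intro k _
    simp

theorem coherentOp_apply_self (z : ℂ) (v w : Fin m → ℂ) (p : Fock m l) :
    coherentOp l l l z v w p p =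
      z ^ (l - ∑ i, p.1 i) / (l - ∑ i, p.1 i).factorial *
        (coherentAmp v p.1 * conj (coherentAmp w p.1)) := by
  have : ∑ i, p.1 i ≤ l := p.2
  simp only [coherentOp, Matrix.sum_apply, Matrix.smul_apply, Matrix.vecMulVec_apply,
    Pi.star_apply, smul_eq_mul, coherent, min_self]
  rw [Finset.sum_eq_single (l - ∑ i, p.1 i)]
  · rw [if_pos (by omega), if_pos (by omega), RCLike.star_def]
  · intro k hk hne
    rw [Finset.mem_range] at hk
    rw [if_neg (by omega), zero_mul, mul_zero]
  · simp

theorem add_pow_div_factorial (x y : ℂ) (n : ℕ) :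
    (x + y) ^ n / n.factorial = ∑ k ∈ Finset.range (n + 1),
      x ^ k / k.factorial * (y ^ (n - k) / (n - k).factorial) := by
  rw [add_pow, Finset.sum_div]
  refine Finset.sum_congr rfl fun k hk => ?_
  have hk' : k ≤ n := Nat.lt_succ_iff.1 (Finset.mem_range.1 hk)
  have hn : (n.factorial : ℂ) ≠ 0 := Nat.cast_ne_zero.2 n.factorial_ne_zero
  rw [Nat.cast_choose ℂ hk']
  field_simp

theorem coherentOp_add (z z' : ℂ) (v w : Fin m → ℂ) :
    coherentOp K a b (z + z') v w = ∑ k ∈ Finset.range (min a b + 1),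
      (z ^ k / k.factorial) • coherentOp K (a - k) (b - k) z' v w := by
  let term (j k : ℕ) : Op m K := (z ^ j / j.factorial * (z' ^ k / k.factorial)) •
    Matrix.vecMulVec (coherent K (a - (j + k)) v) (star (coherent K (b - (j + k)) w))
  calc coherentOp K a b (z + z') v w
      = ∑ n ∈ Finset.range (min a b + 1), ∑ j ∈ Finset.range (n + 1), term j (n - j) := by
        refine Finset.sum_congr rfl fun n _ => ?_
        rw [add_pow_div_factorial, Finset.sum_smul]
        refine Finset.sum_congr rfl fun j hj => ?_
        rw [Finset.mem_range] at hj
        simp only [term, show j + (n - j) = n by omega]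
    _ = ∑ j ∈ Finset.range (min a b + 1), ∑ k ∈ Finset.range (min a b + 1 - j), term j k :=
        Finset.sum_range_diag_flip _ term
    _ = _ := by
        refine Finset.sum_congr rfl fun j hj => ?_
        rw [Finset.mem_range] at hj
        rw [coherentOp, Finset.smul_sum, show min a b + 1 - j = min (a - j) (b - j) + 1 by omega]
        simp only [term, smul_smul, Nat.sub_sub]

theorem secondQuant_mul_coherentOp_mul_conjTranspose (ha : a ≤ K) (hb : b ≤ K)
    (U : Matrix (Fin m) (Fin m) ℂ) (z : ℂ) (v w : Fin m → ℂ) :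
    secondQuant K U * coherentOp K a b z v w * (secondQuant K U)ᴴ =
      coherentOp K a b z (U *ᵥ v) (U *ᵥ w) := by
  rw [coherentOp, Finset.mul_sum, Finset.sum_mul]
  refine Finset.sum_congr rfl fun k _ => ?_
  rw [Matrix.mul_smul, Matrix.smul_mul, Matrix.mul_vecMulVec, Matrix.vecMulVec_mul,
    ← Matrix.star_mulVec, secondQuant_mulVec_coherent (by omega),
    secondQuant_mulVec_coherent (by omega)]

/-- The single-particle matrix of a loss element on mode `i`: only the amplitude of a photon that
survives is recorded, so it is a contraction and not a unitary. -/
def lossMatrix (η : ℝ) (i : Fin m) : Matrix (Fin m) (Fin m) ℂ :=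
  Matrix.diagonal fun j => if j = i then (Real.sqrt η : ℂ) else 1

theorem lossMatrix_mulVec (η : ℝ) (i : Fin m) (v : Fin m → ℂ) (j : Fin m) :
    (lossMatrix η i *ᵥ v) j = (if j = i then (Real.sqrt η : ℂ) else 1) * v j := by
  rw [lossMatrix, Matrix.mulVec_diagonal]

theorem coherentAmp_lossMatrix_mulVec (η : ℝ) (i : Fin m) (v : Fin m → ℂ) (p : Fin m → ℕ) :
    coherentAmp (lossMatrix η i *ᵥ v) p = (Real.sqrt η : ℂ) ^ p i * coherentAmp v p := by
  simp only [coherentAmp, lossMatrix_mulVec, mul_pow, Finset.prod_mul_distrib, ite_pow, one_pow,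
    Finset.prod_ite_eq', Finset.mem_univ, if_true, mul_div_assoc]

theorem sum_update_add (p : Fin m → ℕ) (i : Fin m) (k : ℕ) :
    ∑ j, Function.update p i (p i + k) j = ∑ j, p j + k := by
  rw [Finset.sum_update_of_mem (Finset.mem_univ i),
    ← Finset.add_sum_erase Finset.univ p (Finset.mem_univ i), Finset.sdiff_singleton_eq_erase]
  omega

theorem occFactorial_update_add (p : Fin m → ℕ) (i : Fin m) (k : ℕ) :
    occFactorial (Function.update p i (p i + k)) =
      (p i + k).choose k * k.factorial * occFactorial p := by
  have hfactorial : (p i + k).factorial = (p i + k).choose k * k.factorial * (p i).factorial := by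
    simpa [mul_right_comm] using (Nat.choose_mul_factorial_mul_factorial
      (Nat.le_add_left k (p i))).symm
  simp only [occFactorial, Function.apply_update fun _ => Nat.factorial]
  rw [Finset.prod_update_of_mem (Finset.mem_univ i), hfactorial, mul_assoc,
    Finset.sdiff_singleton_eq_erase,
    Finset.mul_prod_erase Finset.univ (fun j => (p j).factorial) (Finset.mem_univ i)]

theorem prod_pow_update_add (v : Fin m → ℂ) (p : Fin m → ℕ) (i : Fin m) (k : ℕ) :
    ∏ j, v j ^ Function.update p i (p i + k) j = v i ^ k * ∏ j, v j ^ p j := by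
  simp only [Function.apply_update fun j (n : ℕ) => v j ^ n]
  rw [Finset.prod_update_of_mem (Finset.mem_univ i), pow_add, mul_comm (v i ^ p i), mul_assoc,
    Finset.sdiff_singleton_eq_erase,
    Finset.mul_prod_erase Finset.univ (fun j => v j ^ p j) (Finset.mem_univ i)]

theorem sqrt_choose_mul_coherentAmp_update_add (v : Fin m → ℂ) (p : Fin m → ℕ) (i : Fin m)
    (k : ℕ) :
    (Real.sqrt ((p i + k).choose k) : ℂ) * coherentAmp v (Function.update p i (p i + k)) =
      v i ^ k / (Real.sqrt k.factorial : ℂ) * coherentAmp v p := by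
  have hchoose := ofReal_sqrt_ne_zero
    (Nat.cast_pos.2 (Nat.choose_pos (Nat.le_add_left k (p i))))
  rw [coherentAmp, coherentAmp, prod_pow_update_add, occFactorial_update_add, Nat.cast_mul,
    Nat.cast_mul, Real.sqrt_mul (by positivity), Real.sqrt_mul (by positivity)]
  push_cast
  field_simp

theorem sqrt_pow_of_nonneg (h0 : 0 ≤ η) (k : ℕ) : Real.sqrt (η ^ k) = Real.sqrt η ^ k := by
  rw [Real.sqrt_eq_iff_mul_self_eq (by positivity) (by positivity), ← mul_pow,
    Real.mul_self_sqrt h0]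

theorem sqrt_mul_pow_mul_pow (h0 : 0 ≤ η) (h1 : η ≤ 1) {c : ℝ} (hc : 0 ≤ c) (k l : ℕ) :
    Real.sqrt (c * η ^ k * (1 - η) ^ l) =
      Real.sqrt c * Real.sqrt η ^ k * Real.sqrt (1 - η) ^ l := by
  rw [Real.sqrt_mul (by positivity), Real.sqrt_mul hc, sqrt_pow_of_nonneg h0,
    sqrt_pow_of_nonneg (sub_nonneg.2 h1)]

theorem lossKraus_mulVec_coherent_of_le (hl : l ≤ K) (h0 : 0 ≤ η) (h1 : η ≤ 1) (i : Fin m)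
    {k : ℕ} (hk : k ≤ l) (v : Fin m → ℂ) :
    lossKraus K η i k *ᵥ coherent K l v =
      (((Real.sqrt (1 - η) : ℂ) * v i) ^ k / (Real.sqrt k.factorial : ℂ)) •
        coherent K (l - k) (lossMatrix η i *ᵥ v) := by
  funext p
  simp only [Matrix.mulVec, dotProduct, lossKraus, Pi.smul_apply, smul_eq_mul, ite_mul, zero_mul]
  by_cases hp : ∑ j, p.1 j = l - k
  · let q : Fock m K := ⟨Function.update p.1 i (p.1 i + k), by rw [sum_update_add]; omega⟩
    have hq : ∑ j, q.1 j = l := by rw [sum_update_add]; omega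
    have hqi : q.1 i = p.1 i + k := Function.update_self i _ p.1
    rw [Finset.sum_eq_single q (fun q' _ hq' => if_neg fun h => hq' (Subtype.ext h)) (by simp),
      if_pos rfl, coherent, coherent, if_pos hq, if_pos hp, hqi,
      sqrt_mul_pow_mul_pow h0 h1 (Nat.cast_nonneg _), coherentAmp_lossMatrix_mulVec]
    push_cast
    linear_combination (Real.sqrt η : ℂ) ^ p.1 i * (Real.sqrt (1 - η) : ℂ) ^ k *
      sqrt_choose_mul_coherentAmp_update_add v p.1 i k
  · rw [coherent, if_neg hp, mul_zero]
    refine Finset.sum_eq_zero fun q _ => ?_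
    split_ifs with hq
    · rw [coherent, if_neg, mul_zero]
      rw [hq, sum_update_add]
      omega
    · rfl

theorem lossKraus_mulVec_coherent_of_lt (η : ℝ) (i : Fin m) {k : ℕ} (hk : l < k) (v : Fin m → ℂ) :
    lossKraus K η i k *ᵥ coherent K l v = 0 := by
  funext p
  refine Finset.sum_eq_zero fun q _ => ?_
  simp only [lossKraus, coherent]
  split_ifs with hq hsum
  · rw [hq, sum_update_add] at hsum
    omega
  all_goals simp

theorem lossChannel_vecMulVec (η : ℝ) (i : Fin m) (x y : Fock m K → ℂ) :
    lossChannel K η i (Matrix.vecMulVec x (star y)) = ∑ k ∈ Finset.range (K + 1),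
      Matrix.vecMulVec (lossKraus K η i k *ᵥ x) (star (lossKraus K η i k *ᵥ y)) := by
  simp only [lossChannel, Matrix.mul_vecMulVec, Matrix.vecMulVec_mul, Matrix.star_mulVec]

theorem lossChannel_coherentOp_zero (ha : a ≤ K) (hb : b ≤ K) (h0 : 0 ≤ η) (h1 : η ≤ 1)
    (i : Fin m) (v w : Fin m → ℂ) :
    lossChannel K η i (coherentOp K a b 0 v w) =
      coherentOp K a b ((1 - η) * v i * conj (w i)) (lossMatrix η i *ᵥ v)
        (lossMatrix η i *ᵥ w) := by
  have hsub : Finset.range (min a b + 1) ⊆ Finset.range (K + 1) :=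
    Finset.range_subset_range.2 (by omega)
  rw [coherentOp_zero, lossChannel_vecMulVec, coherentOp, ← Finset.sum_subset hsub]
  · refine Finset.sum_congr rfl fun k hk => ?_
    rw [Finset.mem_range] at hk
    have hsq := ofReal_sqrt_mul_self (sub_nonneg.2 h1)
    have hfac := ofReal_sqrt_mul_self (Nat.cast_nonneg k.factorial)
    rw [lossKraus_mulVec_coherent_of_le ha h0 h1 i (by omega),
      lossKraus_mulVec_coherent_of_le hb h0 h1 i (by omega), star_smul, Matrix.smul_vecMulVec,
      Matrix.vecMulVec_smul, smul_smul]
    congr 1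
    simp only [star_div₀, star_pow, star_mul', RCLike.star_def, Complex.conj_ofReal]
    push_cast at hsq hfac
    rw [div_mul_div_comm, ← mul_pow, hfac, ← hsq]
    ring
  · intro k _ hk
    rw [Finset.mem_range] at hk
    rcases Nat.lt_or_ge a k with h | h
    · rw [lossKraus_mulVec_coherent_of_lt η i h, Matrix.zero_vecMulVec]
    · rw [lossKraus_mulVec_coherent_of_lt η i (l := b) (by omega), star_zero,
        Matrix.vecMulVec_zero]

theorem isLinearMap_lossChannel (K : ℕ) (η : ℝ) (i : Fin m) :
    IsLinearMap ℂ (lossChannel K η i) where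
  map_add ρ σ := by simp [lossChannel, Matrix.mul_add, Matrix.add_mul, Finset.sum_add_distrib]
  map_smul c ρ := by simp [lossChannel, Finset.smul_sum]

theorem lossChannel_coherentOp (ha : a ≤ K) (hb : b ≤ K) (h0 : 0 ≤ η) (h1 : η ≤ 1) (i : Fin m)
    (z : ℂ) (v w : Fin m → ℂ) :
    lossChannel K η i (coherentOp K a b z v w) =
      coherentOp K a b (z + (1 - η) * v i * conj (w i)) (lossMatrix η i *ᵥ v)
        (lossMatrix η i *ᵥ w) := by
  have hlin := isLinearMap_lossChannel K η i
  rw [coherentOp_add, coherentOp, ← hlin.mk'_apply, map_sum]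
  refine Finset.sum_congr rfl fun k _ => ?_
  rw [map_smul, ← coherentOp_zero, hlin.mk'_apply,
    lossChannel_coherentOp_zero (by omega) (by omega) h0 h1]

theorem linearMap_ext_coherentOp {M : Type*} [AddCommMonoid M] [Module ℂ M]
    {f g : Op m K →ₗ[ℂ] M}
    (h : ∀ a ≤ K, ∀ b ≤ K, ∀ v w, f (coherentOp K a b 0 v w) = g (coherentOp K a b 0 v w)) :
    f = g := by
  have vecMulVec_eq (x y : Fock m K → ℂ) :
      f (Matrix.vecMulVec x (star y)) = g (Matrix.vecMulVec x (star y)) := by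
    have hx : x ∈ Submodule.span ℂ (coherentSet m K) := span_coherentSet ▸ Submodule.mem_top
    have hy : y ∈ Submodule.span ℂ (coherentSet m K) := span_coherentSet ▸ Submodule.mem_top
    induction hx, hy using Submodule.span_induction₂ with
    | mem_mem x y hx hy =>
      obtain ⟨a, ha, v, rfl⟩ := hx
      obtain ⟨b, hb, w, rfl⟩ := hy
      simpa only [coherentOp_zero] using h a ha b hb v w
    | zero_left y _ => simp only [Matrix.zero_vecMulVec, map_zero]
    | zero_right x _ => simp only [star_zero, Matrix.vecMulVec_zero, map_zero]
    | add_left x x' y _ _ _ hx hx' => simp only [Matrix.add_vecMulVec, map_add, hx, hx']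
    | add_right x y y' _ _ _ hy hy' => simp only [star_add, Matrix.vecMulVec_add, map_add, hy, hy']
    | smul_left c x y _ _ hxy => simp only [Matrix.smul_vecMulVec, map_smul, hxy]
    | smul_right c x y _ _ hxy => simp only [star_smul, Matrix.vecMulVec_smul, map_smul, hxy]
  refine Matrix.ext_linearMap ℂ fun p q => LinearMap.ext_ring ?_
  have hsingle : Matrix.vecMulVec (Pi.single p 1) (star (Pi.single q 1)) =
      (Matrix.single p q 1 : Op m K) := by
    ext p' q'
    simp [Matrix.vecMulVec_apply, Matrix.single_apply, Pi.single_apply, ← ite_and, eq_comm,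
      and_comm]
  have h1 := vecMulVec_eq (Pi.single p 1) (Pi.single q 1)
  rwa [hsingle] at h1

end CoherentOperators

/-! ## Transfer matrices -/

section TransferMatrices

variable {m K a b : ℕ} {η η' : ℝ}

namespace Beamsplitter

variable (g : Beamsplitter m) (v w : Fin m → ℂ)

theorem matrix_mulVec_fst :
    (g.matrix *ᵥ v) g.fst = g.u.1 0 0 * v g.fst + g.u.1 0 1 * v g.snd := by
  rw [Matrix.mulVec, dotProduct, Fintype.sum_eq_add g.fst g.snd g.ne]
  · simp [matrix, g.ne.symm]
  · intro j hj
    simp [matrix, hj.1, hj.2]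

theorem matrix_mulVec_snd :
    (g.matrix *ᵥ v) g.snd = g.u.1 1 0 * v g.fst + g.u.1 1 1 * v g.snd := by
  rw [Matrix.mulVec, dotProduct, Fintype.sum_eq_add g.fst g.snd g.ne]
  · simp [matrix, g.ne.symm]
  · intro j hj
    simp [matrix, hj.1, hj.2, g.ne.symm]

variable {i : Fin m}

theorem matrix_mulVec_of_ne (hfst : i ≠ g.fst) (hsnd : i ≠ g.snd) : (g.matrix *ᵥ v) i = v i := by
  rw [Matrix.mulVec, dotProduct, Finset.sum_eq_single i]
  · simp [matrix, hfst, hsnd]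
  · intro j _ hj
    simp [matrix, hfst, hsnd, hj.symm]
  · simp

theorem sum_eq {M : Type*} [AddCommMonoid M] (f : Fin m → M) :
    ∑ i, f i = f g.fst + f g.snd + ∑ i ∈ {g.fst, g.snd}ᶜ, f i := by
  rw [← Finset.sum_pair g.ne, Finset.sum_add_sum_compl]

theorem matrix_mulVec_dotProduct_star_matrix_mulVec :
    (g.matrix *ᵥ v) ⬝ᵥ star (g.matrix *ᵥ w) = v ⬝ᵥ star w := by
  rw [dotProduct, dotProduct, g.sum_eq, g.sum_eq]
  congr 1
  · simp only [Pi.star_apply, matrix_mulVec_fst, matrix_mulVec_snd, star_add, star_mul']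
    have hu (i j : Fin 2) : star (g.u.1 0 i) * g.u.1 0 j + star (g.u.1 1 i) * g.u.1 1 j =
        (1 : Matrix (Fin 2) (Fin 2) ℂ) i j := by
      rw [← Matrix.mem_unitaryGroup_iff'.1 g.u.2, Matrix.mul_apply, Fin.sum_univ_two]
      rfl
    have h00 := hu 0 0
    have h01 := hu 0 1
    have h10 := hu 1 0
    have h11 := hu 1 1
    simp only [Matrix.one_apply, if_true, zero_ne_one, one_ne_zero, if_false]
      at h00 h01 h10 h11
    linear_combination (v g.fst * star (w g.fst)) * h00 + (v g.snd * star (w g.fst)) * h01 +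
      (v g.fst * star (w g.snd)) * h10 + (v g.snd * star (w g.snd)) * h11
  · refine Finset.sum_congr rfl fun i hi => ?_
    simp only [Finset.mem_compl, Finset.mem_insert, Finset.mem_singleton, not_or] at hi
    rw [Pi.star_apply, Pi.star_apply, g.matrix_mulVec_of_ne v hi.1 hi.2,
      g.matrix_mulVec_of_ne w hi.1 hi.2]

end Beamsplitter

theorem lossMatrix_mulVec_dotProduct_star_lossMatrix_mulVec (h0 : 0 ≤ η) (i : Fin m)
    (v w : Fin m → ℂ) :
    (lossMatrix η i *ᵥ v) ⬝ᵥ star (lossMatrix η i *ᵥ w) =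
      v ⬝ᵥ star w - (1 - η) * v i * conj (w i) := by
  simp only [dotProduct, Pi.star_apply, lossMatrix_mulVec]
  rw [← Finset.add_sum_erase _ _ (Finset.mem_univ i),
    ← Finset.add_sum_erase _ (fun j => v j * star (w j)) (Finset.mem_univ i),
    Finset.sum_congr rfl fun j hj => by rw [if_neg (Finset.ne_of_mem_erase hj), one_mul, one_mul]]
  simp only [if_true, star_mul', RCLike.star_def, Complex.conj_ofReal]
  linear_combination (v i * conj (w i)) * ofReal_sqrt_mul_self h0

/-- The single-particle matrix of an element: its action on the amplitude of a surviving photon. -/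
def Element.transfer (η : ℝ) : Element m → Matrix (Fin m) (Fin m) ℂ
  | .loss i => lossMatrix η i
  | .bs g => g.matrix

/-- The single-particle matrix of a list of elements. As in `channel`, the head acts first. -/
def transfer (η : ℝ) : List (Element m) → Matrix (Fin m) (Fin m) ℂ
  | [] => 1
  | e :: L => transfer η L * e.transfer η

theorem transfer_append (η : ℝ) (L L' : List (Element m)) :
    transfer η (L ++ L') = transfer η L' * transfer η L := by
  induction L with
  | nil => simp [transfer]
  | cons e L ih => simp [transfer, ih, Matrix.mul_assoc]

/-- Elements preserve `z + ⟨w, v⟩`, so the leaked amplitude is determined by the amplitudes of the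
surviving photons. -/
theorem Element.channel_coherentOp (ha : a ≤ K) (hb : b ≤ K) (h0 : 0 ≤ η) (h1 : η ≤ 1)
    (e : Element m) (z : ℂ) (v w : Fin m → ℂ) :
    e.channel K η (coherentOp K a b z v w) = coherentOp K a b
      (z + v ⬝ᵥ star w - (e.transfer η *ᵥ v) ⬝ᵥ star (e.transfer η *ᵥ w))
      (e.transfer η *ᵥ v) (e.transfer η *ᵥ w) := by
  cases e with
  | loss i =>
    rw [channel, lossChannel_coherentOp ha hb h0 h1, transfer,
      lossMatrix_mulVec_dotProduct_star_lossMatrix_mulVec h0]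
    congr 1
    ring
  | bs g =>
    rw [channel, secondQuant_mul_coherentOp_mul_conjTranspose ha hb, transfer,
      g.matrix_mulVec_dotProduct_star_matrix_mulVec, add_sub_cancel_right]

theorem channel_cons (η : ℝ) (e : Element m) (L : List (Element m)) (ρ : Op m K) :
    channel K η (e :: L) ρ = channel K η L (e.channel K η ρ) := rfl

theorem channel_coherentOp (ha : a ≤ K) (hb : b ≤ K) (h0 : 0 ≤ η) (h1 : η ≤ 1)
    (L : List (Element m)) (z : ℂ) (v w : Fin m → ℂ) :
    channel K η L (coherentOp K a b z v w) = coherentOp K a b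
      (z + v ⬝ᵥ star w - (transfer η L *ᵥ v) ⬝ᵥ star (transfer η L *ᵥ w))
      (transfer η L *ᵥ v) (transfer η L *ᵥ w) := by
  induction L generalizing z v w with
  | nil => simp [channel, transfer]
  | cons e L ih =>
    rw [channel_cons, e.channel_coherentOp ha hb h0 h1, ih, transfer]
    simp only [Matrix.mulVec_mulVec, sub_add_cancel]

theorem Element.isLinearMap_channel (K : ℕ) (η : ℝ) (e : Element m) :
    IsLinearMap ℂ (e.channel K η) := by
  cases e with
  | loss i => exact isLinearMap_lossChannel K η i
  | bs g =>
    exact { map_add := by simp [channel, Matrix.mul_add, Matrix.add_mul]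
            map_smul := by simp [channel] }

theorem isLinearMap_channel (K : ℕ) (η : ℝ) (L : List (Element m)) :
    IsLinearMap ℂ (channel K η L) := by
  induction L with
  | nil => exact LinearMap.id.isLinear
  | cons e L ih => exact (ih.mk'.comp (e.isLinearMap_channel K η).mk').isLinear

/-- `channel` as a linear map. -/
def channelLin (K : ℕ) (η : ℝ) (L : List (Element m)) : Op m K →ₗ[ℂ] Op m K :=
  (isLinearMap_channel K η L).mk'

@[simp]
theorem channelLin_apply (η : ℝ) (L : List (Element m)) (ρ : Op m K) :
    channelLin K η L ρ = channel K η L ρ := rfl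

theorem channel_eq_of_transfer_eq (h0 : 0 ≤ η) (h1 : η ≤ 1) (h0' : 0 ≤ η') (h1' : η' ≤ 1)
    {L L' L'' : List (Element m)} (h : transfer η L = transfer η L' * transfer η' L'')
    (ρ : Op m K) :
    channel K η L ρ = channel K η L' (channel K η' L'' ρ) := by
  suffices channelLin K η L = channelLin K η L' ∘ₗ channelLin K η' L'' from
    LinearMap.congr_fun this ρ
  refine linearMap_ext_coherentOp fun a ha b hb v w => ?_
  simp only [LinearMap.comp_apply, channelLin_apply]
  rw [channel_coherentOp ha hb h0 h1, channel_coherentOp ha hb h0' h1',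
    channel_coherentOp ha hb h0 h1, h]
  simp only [Matrix.mulVec_mulVec, sub_add_cancel]

end TransferMatrices

/-! ## Moving losses to the input -/

section LossExtraction

variable {m : ℕ} {η : ℝ}

/-- The single-particle matrix of `d i` loss elements on every mode `i`. -/
def lossesMatrix (η : ℝ) (d : Fin m → ℕ) : Matrix (Fin m) (Fin m) ℂ :=
  Matrix.diagonal fun i => (Real.sqrt η : ℂ) ^ d i

theorem lossesMatrix_add (η : ℝ) (d e : Fin m → ℕ) :
    lossesMatrix η (d + e) = lossesMatrix η d * lossesMatrix η e := by
  simp only [lossesMatrix, Matrix.diagonal_mul_diagonal, Pi.add_apply, pow_add]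

theorem lossMatrix_eq_lossesMatrix_single (η : ℝ) (i : Fin m) :
    lossMatrix η i = lossesMatrix η (Pi.single i 1) := by
  simp only [lossMatrix, lossesMatrix, Pi.single_apply, pow_ite, pow_one, pow_zero]

theorem transfer_map_loss (η : ℝ) (l : List (Fin m)) :
    transfer η (l.map Element.loss) = lossesMatrix η fun i => l.count i := by
  induction l with
  | nil => simp [transfer, lossesMatrix]
  | cons a l ih =>
    rw [List.map_cons, transfer, ih, Element.transfer, lossMatrix_eq_lossesMatrix_single,
      ← lossesMatrix_add]
    congr 1
    funext i
    simp only [List.count_cons, Pi.add_apply, Pi.single_apply, beq_iff_eq, eq_comm (a := i)]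

theorem transfer_map_loss_finRange (h0 : 0 ≤ η) (s : ℕ) :
    transfer (η ^ s) ((List.finRange m).map Element.loss) = lossesMatrix η fun _ => s := by
  rw [transfer_map_loss]
  simp only [List.count_eq_one_of_mem (List.nodup_finRange m) (List.mem_finRange _), lossesMatrix,
    pow_one, sqrt_pow_of_nonneg h0, Complex.ofReal_pow]

/-- The list of modes in which every mode `i` occurs `d i` times. -/
def repeatedModes (d : Fin m → ℕ) : List (Fin m) :=
  (List.finRange m).flatMap fun i => List.replicate (d i) i

theorem count_repeatedModes (d : Fin m → ℕ) (i : Fin m) : (repeatedModes d).count i = d i := by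
  rw [repeatedModes, List.count_flatMap, ← List.ofFn_eq_map, List.sum_ofFn]
  simp [List.count_replicate]

theorem length_repeatedModes (d : Fin m → ℕ) : (repeatedModes d).length = ∑ i, d i := by
  simp only [repeatedModes, List.length_flatMap, List.length_replicate]
  rw [← List.ofFn_eq_map, List.sum_ofFn]

theorem transfer_map_loss_repeatedModes (η : ℝ) (d : Fin m → ℕ) :
    transfer η ((repeatedModes d).map Element.loss) = lossesMatrix η d := by
  simp only [transfer_map_loss, count_repeatedModes]

theorem beamsplitters_append (L L' : List (Element m)) :
    beamsplitters (L ++ L') = beamsplitters L ++ beamsplitters L' := by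
  simp [beamsplitters]

theorem beamsplitters_map_loss (l : List (Fin m)) : beamsplitters (l.map Element.loss) = [] := by
  simp [beamsplitters]

theorem lossCount_append (L L' : List (Element m)) :
    lossCount (L ++ L') = lossCount L + lossCount L' := by
  simp [lossCount]

theorem lossCount_map_loss (l : List (Fin m)) : lossCount (l.map Element.loss) = l.length := by
  simp [lossCount, List.countP_map, Function.comp_def]

theorem Network.elements_cons (g : Beamsplitter m) (N : Network m) :
    Network.elements (g :: N) =
      Element.loss g.fst :: Element.loss g.snd :: Element.bs g :: N.elements := by
  simp [Network.elements]

namespace Beamsplitter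

theorem commute_diagonal_matrix (g : Beamsplitter m) {c : Fin m → ℂ} (h : c g.fst = c g.snd) :
    Commute (Matrix.diagonal c) g.matrix := by
  ext i j
  rw [Matrix.diagonal_mul, Matrix.mul_diagonal, mul_comm]
  by_cases hij : c i = c j
  · rw [hij]
  · have hzero : g.matrix i j = 0 := by
      unfold matrix
      split_ifs <;> simp_all
    rw [hzero, zero_mul, zero_mul]

/-- The losses among `d` that can be pulled through `g` from its output to its input: those in the
arms of `g` have to come in pairs. -/
def movableLosses (g : Beamsplitter m) (d : Fin m → ℕ) : Fin m → ℕ :=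
  fun i => if i = g.fst ∨ i = g.snd then min (d g.fst) (d g.snd) else d i

theorem movableLosses_le (g : Beamsplitter m) (d : Fin m → ℕ) : g.movableLosses d ≤ d := by
  intro i
  simp only [movableLosses]
  split_ifs with hi
  · rcases hi with rfl | rfl <;> omega
  · exact le_rfl

theorem commute_lossesMatrix_movableLosses (g : Beamsplitter m) (η : ℝ) (d : Fin m → ℕ) :
    Commute (lossesMatrix η (g.movableLosses d)) g.matrix :=
  g.commute_diagonal_matrix (by simp [movableLosses])

end Beamsplitter

namespace Network

/-- The smallest number of beamsplitters on a path from the input mode `i`. This is also the number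
of loss elements that can be pulled back to that input. -/
def inputDepth : Network m → Fin m → ℕ
  | [] => 0
  | g :: N => g.movableLosses (inputDepth N) + (Pi.single g.fst 1 + Pi.single g.snd 1)

/-- What is left of a network after all the loss elements that can be pulled back to the inputs have
been removed. -/
def residual : Network m → List (Element m)
  | [] => []
  | g :: N =>
    Element.bs g ::
      ((repeatedModes (inputDepth N - g.movableLosses (inputDepth N))).map Element.loss ++
        residual N)

theorem exists_pathLength_inputDepth (N : Network m) (i : Fin m) :
    ∃ j, PathLength N i j (inputDepth N i) := by
  induction N generalizing i with
  | nil => exact ⟨i, .nil i⟩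
  | cons g N ih =>
    have hne := g.ne
    by_cases hi : i = g.fst ∨ i = g.snd
    · obtain ⟨i', hi', hmin⟩ : ∃ i', (i' = g.fst ∨ i' = g.snd) ∧
          min (inputDepth N g.fst) (inputDepth N g.snd) = inputDepth N i' := by
        rcases min_choice (inputDepth N g.fst) (inputDepth N g.snd) with h | h
        · exact ⟨g.fst, .inl rfl, h⟩
        · exact ⟨g.snd, .inr rfl, h⟩
      obtain ⟨j, hj⟩ := ih i'
      have hdepth : inputDepth (g :: N) i = inputDepth N i' + 1 := by
        rw [inputDepth, Pi.add_apply, Beamsplitter.movableLosses, if_pos hi, hmin]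
        rcases hi with rfl | rfl <;> simp [hne, hne.symm]
      exact ⟨j, hdepth ▸ .hit hi hi' hj⟩
    · obtain ⟨j, hj⟩ := ih i
      have hdepth : inputDepth (g :: N) i = inputDepth N i := by
        rw [inputDepth, Pi.add_apply, Beamsplitter.movableLosses, if_neg hi]
        simp [not_or.1 hi]
      rw [not_or] at hi
      exact ⟨j, hdepth ▸ .miss hi.1 hi.2 hj⟩

theorem minDepth_le_inputDepth (N : Network m) (i : Fin m) : minDepth N ≤ inputDepth N i :=
  Nat.sInf_le ⟨i, N.exists_pathLength_inputDepth i⟩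

theorem beamsplitters_residual (N : Network m) : beamsplitters (residual N) = N := by
  induction N with
  | nil => rfl
  | cons g N ih =>
    change g :: beamsplitters (_ ++ _) = g :: N
    rw [beamsplitters_append, beamsplitters_map_loss, ih, List.nil_append]

theorem lossCount_residual_add_sum_inputDepth (N : Network m) :
    lossCount (residual N) + ∑ i, inputDepth N i = lossCount (elements N) := by
  induction N with
  | nil => simp [residual, inputDepth, elements, lossCount]
  | cons g N ih =>
    have hsum := Finset.sum_tsub_distrib Finset.univ
      fun i _ => g.movableLosses_le (inputDepth N) i
    have hle := Finset.sum_le_sum (s := Finset.univ)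
      fun i _ => g.movableLosses_le (inputDepth N) i
    have hcount : lossCount (elements (g :: N)) = lossCount (elements N) + 2 := by
      simp [elements_cons, lossCount]
    have hresidual : lossCount (residual (g :: N)) =
        ∑ i, (inputDepth N i - g.movableLosses (inputDepth N) i) + lossCount (residual N) := by
      rw [residual, ← List.singleton_append, lossCount_append, lossCount_append,
        lossCount_map_loss, length_repeatedModes]
      simp [lossCount]
    have hdepth : ∑ i, inputDepth (g :: N) i = ∑ i, g.movableLosses (inputDepth N) i + 2 := by
      simp [inputDepth, Finset.sum_add_distrib]
    omega

/-- Losses in both arms of a beamsplitter commute with it, so that all but the unpaired losses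
behind the first beamsplitter move to its input. -/
theorem transfer_elements (η : ℝ) (N : Network m) :
    transfer η (elements N) = transfer η (residual N) * lossesMatrix η (inputDepth N) := by
  induction N with
  | nil => simp [elements, residual, inputDepth, transfer, lossesMatrix]
  | cons g N ih =>
    set moved := g.movableLosses (inputDepth N) with hmoved
    have hsplit : lossesMatrix η (inputDepth N) =
        lossesMatrix η (inputDepth N - moved) * lossesMatrix η moved := by
      rw [← lossesMatrix_add, tsub_add_cancel_of_le (g.movableLosses_le (inputDepth N))]
    have hcomm := (g.commute_lossesMatrix_movableLosses η (inputDepth N)).eq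
    rw [← hmoved] at hcomm
    simp only [elements_cons, residual, inputDepth, transfer, transfer_append, Element.transfer,
      transfer_map_loss_repeatedModes, ih, hsplit, lossMatrix_eq_lossesMatrix_single]
    simp only [← hmoved, Matrix.mul_assoc]
    rw [← Matrix.mul_assoc (lossesMatrix η moved) g.matrix, hcomm,
      add_comm (Pi.single g.fst 1), lossesMatrix_add η moved, lossesMatrix_add, Matrix.mul_assoc]

theorem exists_uniform_losses (h0 : 0 ≤ η) (N : Network m) :
    ∃ L : List (Element m), beamsplitters L = N ∧
      lossCount L + minDepth N * m = lossCount (elements N) ∧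
      transfer η (elements N) =
        transfer η L * transfer (η ^ minDepth N) ((List.finRange m).map Element.loss) := by
  let s : Fin m → ℕ := fun _ => minDepth N
  have hs : s ≤ inputDepth N := N.minDepth_le_inputDepth
  refine ⟨(repeatedModes (inputDepth N - s)).map Element.loss ++ residual N, ?_, ?_, ?_⟩
  · rw [beamsplitters_append, beamsplitters_map_loss, beamsplitters_residual, List.nil_append]
  · have hsum : ∑ i, (inputDepth N - s) i + minDepth N * m = ∑ i, inputDepth N i := by
      calc ∑ i, (inputDepth N - s) i + minDepth N * m = ∑ i, (inputDepth N - s + s) i := by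
            simp [s, Finset.sum_add_distrib, mul_comm]
        _ = ∑ i, inputDepth N i := by rw [tsub_add_cancel_of_le hs]
    rw [lossCount_append, lossCount_map_loss, length_repeatedModes,
      ← lossCount_residual_add_sum_inputDepth]
    omega
  · rw [transfer_elements, transfer_append, transfer_map_loss_repeatedModes,
      transfer_map_loss_finRange h0, Matrix.mul_assoc, ← lossesMatrix_add,
      tsub_add_cancel_of_le hs]

end Network

end LossExtraction

/-! ## Phase-averaged product states -/

section PhaseLaw

variable {n : ℕ}

/-- The law of a uniformly random angle of `[0, 2π]`, written as the image of a uniform number of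
`[0, 1]` because this is how `Cmd.phase` draws it. -/
def angleLaw : Measure ℝ :=
  (volume : Measure unitInterval).map fun x : unitInterval => 2 * Real.pi * (x : ℝ)

instance isProbabilityMeasure_angleLaw : IsProbabilityMeasure angleLaw :=
  Measure.isProbabilityMeasure_map (by fun_prop)

theorem angleLaw_eq :
    angleLaw = ENNReal.ofReal (2 * Real.pi)⁻¹ • volume.restrict (Set.Icc 0 (2 * Real.pi)) := by
  have hpreimage :
      (fun x : ℝ => 2 * Real.pi * x) ⁻¹' Set.Icc 0 (2 * Real.pi) = unitInterval := by
    simp [Set.preimage_const_mul_Icc₀ _ _ Real.two_pi_pos, Real.two_pi_pos.ne', unitInterval]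
  calc angleLaw
      = ((volume : Measure ℝ).restrict unitInterval).map fun x : ℝ => 2 * Real.pi * x := by
        rw [← unitInterval.measurePreserving_coe.map_eq,
          Measure.map_map (by fun_prop) measurable_subtype_coe]
        rfl
    _ = _ := by
        rw [← hpreimage, ← Measure.restrict_map (by fun_prop) measurableSet_Icc,
          Real.map_volume_mul_left Real.two_pi_pos.ne', Measure.restrict_smul,
          abs_of_pos (inv_pos.2 Real.two_pi_pos)]

/-- The law of `n` independent uniformly random angles of `[0, 2π]`. -/
def phaseLaw (n : ℕ) : Measure (Fin n → ℝ) := Measure.pi fun _ => angleLaw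

instance isProbabilityMeasure_phaseLaw : IsProbabilityMeasure (phaseLaw n) := by
  unfold phaseLaw
  infer_instance

theorem phaseLaw_eq : phaseLaw n = ENNReal.ofReal ((2 * Real.pi) ^ n)⁻¹ •
    volume.restrict (Set.Icc (0 : Fin n → ℝ) fun _ => 2 * Real.pi) := by
  refine Measure.pi_eq fun s _ => ?_
  rw [← Set.pi_univ_Icc, volume_pi, Measure.restrict_pi_pi, Measure.smul_apply, Measure.pi_pi]
  simp only [angleLaw_eq, Measure.smul_apply, smul_eq_mul, Finset.prod_mul_distrib,
    Finset.prod_const, Finset.card_univ, Fintype.card_fin, Pi.zero_apply, ← inv_pow,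
    ENNReal.ofReal_pow (inv_pos.2 Real.two_pi_pos).le]

variable {E : Type*} [NormedAddCommGroup E]

theorem integral_phaseLaw [NormedSpace ℝ E] (f : (Fin n → ℝ) → E) :
    ∫ φ, f φ ∂phaseLaw n = ((2 * Real.pi) ^ n)⁻¹ •
      ∫ φ in Set.Icc (0 : Fin n → ℝ) fun _ => 2 * Real.pi, f φ := by
  rw [phaseLaw_eq, integral_smul_measure, ENNReal.toReal_ofReal (by positivity)]

theorem integrable_phaseLaw_of_continuous {f : (Fin n → ℝ) → E} (hf : Continuous f) :
    Integrable f (phaseLaw n) := by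
  rw [phaseLaw_eq]
  exact (hf.continuousOn.integrableOn_compact isCompact_Icc).smul_measure ENNReal.ofReal_ne_top

end PhaseLaw

section ProductStates

variable {m n : ℕ} {η t : ℝ}

/-- The projector onto `|v⟩^{⊗ l}`. -/
def productOp (K : ℕ) (v : Fin m → ℂ) (l : ℕ) : Op m K :=
  Matrix.vecMulVec (productVec K v l) (star (productVec K v l))

theorem productOp_eq_smul_coherentOp (K : ℕ) (v : Fin m → ℂ) (l : ℕ) :
    productOp K v l = (l.factorial : ℂ) • coherentOp K l l 0 v v := by
  have hsqrt := ofReal_sqrt_mul_self (Nat.cast_nonneg l.factorial)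
  rw [Complex.ofReal_natCast] at hsqrt
  rw [productOp, productVec_eq_smul_coherent, coherentOp_zero, star_smul, RCLike.star_def,
    Complex.conj_ofReal, Matrix.smul_vecMulVec, Matrix.vecMulVec_smul, smul_smul, hsqrt]

theorem continuous_phaseState (i : Fin m) : Continuous fun φ : Fin n → ℝ => phaseState m n φ i := by
  unfold phaseState
  split_ifs <;> fun_prop

theorem continuous_productVec_phaseState (K l : ℕ) (p : Fock m K) :
    Continuous fun φ : Fin n → ℝ => productVec K (phaseState m n φ) l p := by
  simp only [productVec_eq_smul_coherent, Pi.smul_apply, coherent, coherentAmp]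
  have := continuous_phaseState (m := m) (n := n)
  split_ifs <;> fun_prop

theorem continuous_productOp_phaseState (K l : ℕ) (p q : Fock m K) :
    Continuous fun φ : Fin n → ℝ => productOp K (phaseState m n φ) l p q :=
  (continuous_productVec_phaseState K l p).mul
    (Complex.continuous_conj.comp (continuous_productVec_phaseState K l q))

theorem sepState_apply (l : ℕ) (p q : Fock m n) :
    sepState m n l p q = ∫ φ, productOp n (phaseState m n φ) l p q ∂phaseLaw n := by
  rw [integral_phaseLaw, Complex.real_smul, Complex.ofReal_inv]
  rfl

theorem linearMap_apply_eq_sum {K : ℕ} (ψ : Op m K →ₗ[ℂ] ℂ) (ρ : Op m K) :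
    ψ ρ = ∑ p, ∑ q, ρ p q * ψ (Matrix.single p q 1) := by
  conv_lhs => rw [Matrix.matrix_eq_sum_single ρ]
  simp only [map_sum]
  refine Finset.sum_congr rfl fun p _ => Finset.sum_congr rfl fun q _ => ?_
  rw [← smul_eq_mul, ← map_smul, Matrix.smul_single, smul_eq_mul, mul_one]

theorem linearMap_sepState (l : ℕ) (ψ : Op m n →ₗ[ℂ] ℂ) :
    ψ (sepState m n l) = ∫ φ, ψ (productOp n (phaseState m n φ) l) ∂phaseLaw n := by
  have hintegrable (p q : Fock m n) : Integrable (fun φ : Fin n → ℝ =>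
      productOp n (phaseState m n φ) l p q * ψ (Matrix.single p q 1)) (phaseLaw n) :=
    integrable_phaseLaw_of_continuous
      ((continuous_productOp_phaseState n l p q).mul continuous_const)
  have hentries (φ : Fin n → ℝ) := linearMap_apply_eq_sum ψ (productOp n (phaseState m n φ) l)
  rw [linearMap_apply_eq_sum]
  simp only [hentries, sepState_apply, ← integral_mul_const]
  rw [integral_finsetSum _ fun p _ => integrable_finsetSum _ fun q _ => hintegrable p q]
  exact Finset.sum_congr rfl fun p _ => (integral_finsetSum _ fun q _ => hintegrable p q).symm

theorem channel_sepState_apply (l : ℕ) (L : List (Element m)) (p q : Fock m n) :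
    channel n η L (sepState m n l) p q =
      ∫ φ, channel n η L (productOp n (phaseState m n φ) l) p q ∂phaseLaw n :=
  linearMap_sepState l (Matrix.entryLinearMap ℂ ℂ p q ∘ₗ channelLin n η L)

theorem phaseState_mul_conj (φ : Fin n → ℝ) (i : Fin m) :
    phaseState m n φ i * conj (phaseState m n φ i) = if i.1 < n then (n : ℂ)⁻¹ else 0 := by
  unfold phaseState
  split_ifs with hi
  · have hexp : ‖Complex.exp (-(Complex.I * (φ ⟨i.1, hi⟩ : ℂ)))‖ = 1 := by
      rw [← mul_neg, ← Complex.ofReal_neg, Complex.norm_exp_I_mul_ofReal]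
    rw [Complex.mul_conj', norm_div, hexp, Complex.norm_real,
      Real.norm_of_nonneg (Real.sqrt_nonneg _), one_div, ← Complex.ofReal_pow, inv_pow,
      Real.sq_sqrt n.cast_nonneg, Complex.ofReal_inv, Complex.ofReal_natCast]
  · exact zero_mul _

theorem phaseState_dotProduct_star (hnm : n ≤ m) (hn : n ≠ 0) (φ : Fin n → ℝ) :
    phaseState m n φ ⬝ᵥ star (phaseState m n φ) = 1 := by
  simp only [dotProduct, Pi.star_apply, RCLike.star_def, phaseState_mul_conj]
  rw [← Finset.sum_filter, Finset.sum_const, Fin.card_filter_val_lt, min_eq_right hnm,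
    nsmul_eq_mul, mul_inv_cancel₀ (Nat.cast_ne_zero.2 hn)]

theorem uniformLoss_productOp {v : Fin m → ℂ} (hv : n ≠ 0 → v ⬝ᵥ star v = 1)
    (h0 : 0 ≤ t) (h1 : t ≤ 1) :
    uniformLoss n t (productOp n v n) = ∑ l ∈ Finset.range (n + 1),
      (((n.choose l : ℝ) * t ^ l * (1 - t) ^ (n - l) : ℝ) : ℂ) • productOp n v l := by
  have htransfer :
      transfer t ((List.finRange m).map Element.loss) *ᵥ v = (Real.sqrt t : ℂ) • v := by
    have h := transfer_map_loss_finRange (m := m) h0 1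
    rw [pow_one] at h
    rw [h, lossesMatrix]
    ext i
    simp [Matrix.mulVec_diagonal]
  have hsqrt := ofReal_sqrt_mul_self h0
  have hleak {k : ℕ} (hk : k ≤ n) : (0 + v ⬝ᵥ star v - ((Real.sqrt t : ℂ) • v) ⬝ᵥ
      star ((Real.sqrt t : ℂ) • v)) ^ k = (1 - t : ℂ) ^ k := by
    rcases Nat.eq_zero_or_pos k with rfl | hk0
    · simp
    · rw [star_smul, RCLike.star_def, Complex.conj_ofReal, smul_dotProduct, dotProduct_smul,
        smul_smul, hsqrt, hv (by omega), zero_add, smul_eq_mul, mul_one]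
  rw [productOp_eq_smul_coherentOp, uniformLoss, (isLinearMap_channel _ _ _).map_smul,
    channel_coherentOp le_rfl le_rfl h0 h1, htransfer, coherentOp, min_self,
    Finset.smul_sum, ← Finset.sum_range_reflect]
  refine Finset.sum_congr rfl fun l hl => ?_
  have hl' : l ≤ n := Nat.lt_succ_iff.1 (Finset.mem_range.1 hl)
  rw [show n + 1 - 1 - l = n - l by omega, Nat.sub_sub_self hl', hleak (Nat.sub_le n l),
    coherent_smul, productOp_eq_smul_coherentOp, coherentOp_zero, star_smul,
    Matrix.smul_vecMulVec, Matrix.vecMulVec_smul, smul_smul, smul_smul, smul_smul, smul_smul,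
    star_pow, RCLike.star_def, Complex.conj_ofReal, mul_assoc, ← mul_pow, hsqrt,
    ← Nat.choose_mul_factorial_mul_factorial hl']
  congr 1
  have hfactorial : ((n - l).factorial : ℂ) ≠ 0 := Nat.cast_ne_zero.2 (Nat.factorial_ne_zero _)
  push_cast
  field_simp

theorem uniformLoss_sepState (hnm : n ≤ m) (h0 : 0 ≤ t) (h1 : t ≤ 1) :
    uniformLoss n t (sepState m n n) = sepMixture m n t := by
  ext p q
  have hloss (φ : Fin n → ℝ) :=
    uniformLoss_productOp (fun hn => phaseState_dotProduct_star hnm hn φ) h0 h1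
  simp only [uniformLoss] at hloss ⊢
  simp only [channel_sepState_apply, hloss, sepMixture, Matrix.sum_apply, Matrix.smul_apply,
    smul_eq_mul, sepState_apply, ← integral_const_mul]
  exact integral_finsetSum _ fun l _ =>
    (integrable_phaseLaw_of_continuous (continuous_productOp_phaseState n l p q)).const_mul _

/-- The probability that `n` independent particles, each of which is found in mode `j` with
probability `c j` and is lost otherwise, produce the counts `p`. It is only meaningful for counts
with at most `n` particles in total, the subtraction being truncated. -/
def multinomialProb (n : ℕ) (c : Fin m → ℝ) (p : Fin m → ℕ) : ℝ :=
  n.factorial / ((n - ∑ i, p i).factorial * occFactorial p) *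
    ((∏ i, c i ^ p i) * (1 - ∑ i, c i) ^ (n - ∑ i, p i))

theorem channel_productOp_apply_self {v : Fin m → ℂ} (hv : n ≠ 0 → v ⬝ᵥ star v = 1)
    (h0 : 0 ≤ η) (h1 : η ≤ 1) (L : List (Element m)) (p : Fock m n) :
    channel n η L (productOp n v n) p p =
      (multinomialProb n (fun j => Complex.normSq ((transfer η L *ᵥ v) j)) p.1 : ℂ) := by
  have hleak (w : Fin m → ℂ) :
      (0 + v ⬝ᵥ star v - w ⬝ᵥ star w) ^ (n - ∑ i, p.1 i) =
        (1 - ∑ i, (Complex.normSq (w i) : ℂ)) ^ (n - ∑ i, p.1 i) := by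
    rcases eq_or_ne n 0 with rfl | hn
    · simp
    · rw [hv hn, zero_add]
      simp only [dotProduct, Pi.star_apply, RCLike.star_def, Complex.mul_conj]
  rw [productOp_eq_smul_coherentOp, (isLinearMap_channel _ _ _).map_smul, Matrix.smul_apply,
    channel_coherentOp le_rfl le_rfl h0 h1, coherentOp_apply_self, conj_coherentAmp,
    coherentAmp_mul_coherentAmp, hleak, multinomialProb, smul_eq_mul]
  simp only [Pi.star_apply, RCLike.star_def, Complex.mul_conj]
  push_cast
  ring

theorem outputDist_channel_sepState (hnm : n ≤ m) (h0 : 0 ≤ η) (h1 : η ≤ 1)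
    (L : List (Element m)) (p : Fock m n) :
    outputDist (channel n η L (sepState m n n)) p = ∫ φ, multinomialProb n
      (fun j => Complex.normSq ((transfer η L *ᵥ phaseState m n φ) j)) p.1 ∂phaseLaw n := by
  have hdiag (φ : Fin n → ℝ) :=
    channel_productOp_apply_self (fun hn => phaseState_dotProduct_star hnm hn φ) h0 h1 L p
  rw [outputDist, channel_sepState_apply]
  simp only [hdiag]
  rw [integral_complex_ofReal, Complex.ofReal_re]

end ProductStates

/-! ## Data processing -/

section DataProcessing

open scoped ComplexOrder

variable {m K a b l l' : ℕ} {η : ℝ}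

theorem Element.posSemidef_channel (η : ℝ) (e : Element m) {ρ : Op m K} (h : ρ.PosSemidef) :
    (e.channel K η ρ).PosSemidef := by
  cases e with
  | loss i => exact Matrix.posSemidef_sum _ fun k _ => h.mul_mul_conjTranspose_same _
  | bs g => exact h.mul_mul_conjTranspose_same _

theorem posSemidef_channel (η : ℝ) :
    ∀ (L : List (Element m)) {ρ : Op m K}, ρ.PosSemidef → (channel K η L ρ).PosSemidef
  | [], _, h => h
  | e :: L, _, h => posSemidef_channel η L (e.posSemidef_channel η h)

theorem coherent_dotProduct_star_coherent_of_ne (h : l ≠ l') (v w : Fin m → ℂ) :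
    coherent K l v ⬝ᵥ star (coherent K l' w) = 0 := by
  refine Finset.sum_eq_zero fun p _ => ?_
  simp only [coherent, Pi.star_apply]
  split_ifs with hl hl'
  · exact absurd (hl.symm.trans hl') h
  all_goals simp

theorem trace_coherentOp (ha : a ≤ K) (z : ℂ) (v w : Fin m → ℂ) :
    (coherentOp K a b z v w).trace =
      if a = b then (z + v ⬝ᵥ star w) ^ a / a.factorial else 0 := by
  simp only [coherentOp, Matrix.trace_sum, Matrix.trace_smul, Matrix.trace_vecMulVec, smul_eq_mul]
  split_ifs with h
  · subst h
    rw [add_pow_div_factorial, min_self]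
    exact Finset.sum_congr rfl fun k _ => by
      rw [coherent_dotProduct_star_coherent ((Nat.sub_le a k).trans ha)]
  · refine Finset.sum_eq_zero fun k hk => ?_
    rw [Finset.mem_range] at hk
    rw [coherent_dotProduct_star_coherent_of_ne (by omega), mul_zero]

theorem trace_channel (h0 : 0 ≤ η) (h1 : η ≤ 1) (L : List (Element m)) (ρ : Op m K) :
    (channel K η L ρ).trace = ρ.trace := by
  suffices Matrix.traceLinearMap (Fock m K) ℂ ℂ ∘ₗ channelLin K η L =
      Matrix.traceLinearMap (Fock m K) ℂ ℂ from LinearMap.congr_fun this ρ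
  refine linearMap_ext_coherentOp fun a ha b hb v w => ?_
  simp only [LinearMap.comp_apply, channelLin_apply, Matrix.traceLinearMap_apply]
  rw [channel_coherentOp ha hb h0 h1, trace_coherentOp ha, trace_coherentOp ha, sub_add_cancel]

theorem outputDist_nonneg {ρ : Op m K} (h : ρ.PosSemidef) (p : Fock m K) : 0 ≤ outputDist ρ p :=
  (Complex.le_def.1 (h.diag_nonneg (i := p))).1

theorem sum_outputDist (ρ : Op m K) : ∑ p, outputDist ρ p = ρ.trace.re := by
  rw [Matrix.trace, Complex.re_sum]
  rfl

theorem outputDist_sub (ρ σ : Op m K) (p : Fock m K) :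
    outputDist (ρ - σ) p = outputDist ρ p - outputDist σ p := by
  simp [outputDist]

theorem outputDist_channel_diagonal (η : ℝ) (L : List (Element m)) (d : Fock m K → ℝ)
    (p : Fock m K) :
    outputDist (channel K η L (Matrix.diagonal fun q => (d q : ℂ))) p =
      ∑ q, d q * outputDist (channel K η L (Matrix.single q q 1)) p := by
  have hdiagonal : Matrix.diagonal (fun q => (d q : ℂ)) =
      ∑ q, (d q : ℂ) • Matrix.single q q (1 : ℂ) := by
    simp only [Matrix.smul_single, smul_eq_mul, mul_one, Matrix.sum_single_eq_diagonal]
  rw [hdiagonal, ← channelLin_apply, map_sum]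
  simp only [map_smul, channelLin_apply, outputDist, Matrix.sum_apply, Matrix.smul_apply,
    smul_eq_mul, Complex.re_sum, Complex.re_ofReal_mul]

theorem sum_abs_sum_mul_le {α β : Type*} [Fintype α] [Fintype β] {κ : α → β → ℝ}
    (hκ : ∀ q p, 0 ≤ κ q p) (hsum : ∀ q, ∑ p, κ q p = 1) (d : α → ℝ) :
    ∑ p, |∑ q, d q * κ q p| ≤ ∑ q, |d q| :=
  calc ∑ p, |∑ q, d q * κ q p|
      ≤ ∑ p, ∑ q, |d q| * κ q p := by
        refine Finset.sum_le_sum fun p _ => (Finset.abs_sum_le_sum_abs _ _).trans_eq ?_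
        exact Finset.sum_congr rfl fun q _ => by rw [abs_mul, abs_of_nonneg (hκ q p)]
    _ = ∑ q, |d q| := by
        rw [Finset.sum_comm]
        simp only [← Finset.mul_sum, hsum, mul_one]

theorem tvDist_channel_le (h0 : 0 ≤ η) (h1 : η ≤ 1) (L : List (Element m)) {ρ σ : Op m K}
    {d : Fock m K → ℝ} (h : ρ - σ = Matrix.diagonal fun p => (d p : ℂ)) :
    tvDist (outputDist (channel K η L ρ)) (outputDist (channel K η L σ)) ≤
      (1 / 2) * ∑ p, |d p| := by
  have hsingle (q : Fock m K) : (Matrix.single q q (1 : ℂ)).PosSemidef := by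
    rw [← Matrix.diagonal_single, Matrix.posSemidef_diagonal_iff]
    intro p
    exact (Pi.single_nonneg.2 zero_le_one : (0 : Fock m K → ℂ) ≤ Pi.single q 1) p
  have hdiff (p : Fock m K) :
      outputDist (channel K η L ρ) p - outputDist (channel K η L σ) p =
        ∑ q, d q * outputDist (channel K η L (Matrix.single q q 1)) p := by
    rw [← outputDist_sub, ← outputDist_channel_diagonal, ← h]
    simp only [← channelLin_apply, map_sub]
  simp only [tvDist, hdiff]
  refine mul_le_mul_of_nonneg_left (sum_abs_sum_mul_le (fun q p =>
    outputDist_nonneg (posSemidef_channel η L (hsingle q)) p) (fun q => ?_) d) (by norm_num)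
  rw [sum_outputDist, trace_channel h0 h1, Matrix.trace_single_eq_same, Complex.one_re]

end DataProcessing

section Distances

variable {α : Type*} [Fintype α]

theorem tvDist_comm (P Q : α → ℝ) : tvDist P Q = tvDist Q P := by
  simp only [tvDist, abs_sub_comm]

variable [DecidableEq α]

theorem map_eigenvalues_eq_of_eq_diagonal {A : Matrix α α ℂ} (hA : A.IsHermitian) {d : α → ℝ}
    (h : A = Matrix.diagonal fun i => (d i : ℂ)) :
    Finset.univ.val.map (fun i => (hA.eigenvalues i : ℂ)) =
      Finset.univ.val.map fun i => (d i : ℂ) := by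
  have hroots : A.charpoly.roots = Finset.univ.val.map fun i => (d i : ℂ) := by
    rw [h, Matrix.charpoly_diagonal, Polynomial.roots_prod _ _
      (Finset.prod_ne_zero_iff.2 fun i _ => Polynomial.X_sub_C_ne_zero _)]
    simp only [Polynomial.roots_X_sub_C]
    exact Multiset.bind_singleton _ _
  exact hA.roots_charpoly_eq_eigenvalues.symm.trans hroots

theorem traceDist_of_sub_eq_diagonal {ρ σ : Matrix α α ℂ} {d : α → ℝ}
    (h : ρ - σ = Matrix.diagonal fun i => (d i : ℂ)) :
    traceDist ρ σ = (1 / 2) * ∑ i, |d i| := by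
  have hsq : (ρ - σ).conjTranspose * (ρ - σ) = Matrix.diagonal fun i => ((d i ^ 2 : ℝ) : ℂ) := by
    rw [h, Matrix.diagonal_conjTranspose, Matrix.diagonal_mul_diagonal]
    congr 1
    funext i
    simp [sq]
  have heigenvalues := congrArg (fun s => (s.map fun z : ℂ => Real.sqrt z.re).sum)
    (map_eigenvalues_eq_of_eq_diagonal (Matrix.isHermitian_conjTranspose_mul_self (ρ - σ)) hsq)
  simp only [Multiset.map_map, Function.comp_def, Complex.ofReal_re, Real.sqrt_sq_eq_abs]
    at heigenvalues
  exact congrArg (1 / 2 * ·) heigenvalues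

end Distances

/-! ## Uniform losses on a Fock state -/

section LossOnFockStates

variable {m K : ℕ} {t : ℝ}

/-- The probability that `a` of `s` photons survive. -/
def survivalProb (t : ℝ) (s a : ℕ) : ℝ := (s.choose a : ℝ) * t ^ a * (1 - t) ^ (s - a)

/-- The probability that losses on the modes in `A` turn the occupation numbers `s` into `p`. -/
def survivalLaw (t : ℝ) (s : Fin m → ℕ) (A : Finset (Fin m)) (p : Fin m → ℕ) : ℝ :=
  ∏ j, if j ∈ A then survivalProb t (s j) (p j) else if p j = s j then 1 else 0

theorem survivalLaw_empty (t : ℝ) (s p : Fin m → ℕ) :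
    survivalLaw t s ∅ p = if p = s then 1 else 0 := by
  simp only [survivalLaw, Finset.notMem_empty, if_false, Finset.prod_ite_zero, Finset.mem_univ,
    forall_const, Finset.prod_const_one, funext_iff]

theorem survivalLaw_univ (t : ℝ) (s p : Fin m → ℕ) :
    survivalLaw t s Finset.univ p = ∏ j, survivalProb t (s j) (p j) := by
  simp only [survivalLaw, Finset.mem_univ, if_true]

theorem survivalLaw_eq_zero_of_sum_lt (t : ℝ) {s p : Fin m → ℕ} (A : Finset (Fin m))
    (h : ∑ j, s j < ∑ j, p j) : survivalLaw t s A p = 0 := by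
  obtain ⟨j, -, hj⟩ := Finset.exists_lt_of_sum_lt h
  refine Finset.prod_eq_zero (Finset.mem_univ j) ?_
  rw [survivalProb, Nat.choose_eq_zero_of_lt hj, if_neg hj.ne']
  simp

theorem sum_choose_mul_survivalLaw_update {s : Fin m → ℕ} {A : Finset (Fin m)} {i : Fin m}
    (hi : i ∉ A) (hs : s i ≤ K) (p : Fin m → ℕ) :
    ∑ k ∈ Finset.range (K + 1), ((p i + k).choose k : ℝ) * t ^ p i * (1 - t) ^ k *
        survivalLaw t s A (Function.update p i (p i + k)) =
      survivalLaw t s (insert i A) p := by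
  set rest : ℝ := ∏ j ∈ Finset.univ.erase i,
    if j ∈ A then survivalProb t (s j) (p j) else if p j = s j then 1 else 0
  have hupdate (k : ℕ) : survivalLaw t s A (Function.update p i (p i + k)) =
      (if p i + k = s i then 1 else 0) * rest := by
    rw [survivalLaw, ← Finset.mul_prod_erase _ _ (Finset.mem_univ i), if_neg hi,
      Function.update_self]
    congr 1
    refine Finset.prod_congr rfl fun j hj => ?_
    rw [Function.update_of_ne (Finset.ne_of_mem_erase hj)]
  have hinsert : survivalLaw t s (insert i A) p = survivalProb t (s i) (p i) * rest := by
    rw [survivalLaw, ← Finset.mul_prod_erase _ _ (Finset.mem_univ i),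
      if_pos (Finset.mem_insert_self _ _)]
    congr 1
    refine Finset.prod_congr rfl fun j hj => ?_
    simp only [Finset.mem_insert, Finset.ne_of_mem_erase hj, false_or]
  simp only [hupdate, hinsert, ite_mul, one_mul, zero_mul, mul_ite, mul_zero]
  rcases le_or_gt (p i) (s i) with hle | hlt
  · rw [Finset.sum_eq_single_of_mem (s i - p i) (Finset.mem_range.2 (by omega))
      (fun k _ hk => if_neg (by omega)), if_pos (by omega), survivalProb,
      Nat.add_sub_cancel' hle, Nat.choose_symm hle]
  · rw [survivalProb, Nat.choose_eq_zero_of_lt hlt,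
      Finset.sum_eq_zero fun k _ => if_neg (by omega)]
    simp

theorem lossKraus_mul_diagonal_mul_conjTranspose_apply (h0 : 0 ≤ t) (h1 : t ≤ 1) (i : Fin m)
    (k : ℕ) {f : (Fin m → ℕ) → ℝ} (hf : ∀ q, K < ∑ j, q j → f q = 0) (p p' : Fock m K) :
    (lossKraus K t i k * Matrix.diagonal (fun q : Fock m K => (f q.1 : ℂ)) *
        (lossKraus K t i k).conjTranspose) p p' =
      if p = p' then ((((p.1 i + k).choose k : ℝ) * t ^ p.1 i * (1 - t) ^ k *
        f (Function.update p.1 i (p.1 i + k)) : ℝ) : ℂ) else 0 := by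
  have hterm (q : Fock m K) :
      lossKraus K t i k p q * (f q.1 : ℂ) * conj (lossKraus K t i k p' q) =
        if q.1 = Function.update p.1 i (p.1 i + k) ∧ p = p' then
          ((((p.1 i + k).choose k : ℝ) * t ^ p.1 i * (1 - t) ^ k * f q.1 : ℝ) : ℂ) else 0 := by
    by_cases hq : q.1 = Function.update p.1 i (p.1 i + k)
    swap
    · simp [lossKraus, hq]
    by_cases hp : p = p'
    · have hweight : 0 ≤ ((p.1 i + k).choose k : ℝ) * t ^ p.1 i * (1 - t) ^ k := by
        have := sub_nonneg.2 h1
        positivity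
      subst hp
      simp only [lossKraus, hq, Function.update_self, and_self, if_true, Complex.conj_ofReal,
        Complex.ofReal_mul _ (f _), ← ofReal_sqrt_mul_self hweight]
      ring
    · have hq' : q.1 ≠ Function.update p'.1 i (p'.1 i + k) := by
        intro hq'
        refine hp (Subtype.ext (funext fun j => ?_))
        have hj := congrFun (hq.symm.trans hq') j
        rcases eq_or_ne j i with rfl | hji
        · simpa using hj
        · simpa [hji] using hj
      simp [lossKraus, hq', hp]
  rw [Matrix.mul_apply]
  simp only [Matrix.mul_diagonal, Matrix.conjTranspose_apply, RCLike.star_def, hterm]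
  split_ifs with hp
  · simp only [hp, and_true]
    by_cases hK : ∑ j, Function.update p'.1 i (p'.1 i + k) j ≤ K
    · rw [Finset.sum_eq_single_of_mem (⟨_, hK⟩ : Fock m K) (Finset.mem_univ _)
        fun q _ hq => if_neg fun h => hq (Subtype.ext h), if_pos rfl]
    · rw [hf _ (not_le.1 hK), mul_zero, Complex.ofReal_zero]
      exact Finset.sum_eq_zero fun q _ => if_neg fun h => hK (by rw [← h]; exact q.2)
  · simp only [hp, and_false, if_false, Finset.sum_const_zero]

theorem lossChannel_diagonal (h0 : 0 ≤ t) (h1 : t ≤ 1) (i : Fin m) {f : (Fin m → ℕ) → ℝ}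
    (hf : ∀ q, K < ∑ j, q j → f q = 0) :
    lossChannel K t i (Matrix.diagonal fun p => (f p.1 : ℂ)) =
      Matrix.diagonal fun p => ((∑ k ∈ Finset.range (K + 1), ((p.1 i + k).choose k : ℝ) *
        t ^ p.1 i * (1 - t) ^ k * f (Function.update p.1 i (p.1 i + k)) : ℝ) : ℂ) := by
  ext p p'
  simp only [lossChannel, Matrix.sum_apply, Matrix.diagonal_apply,
    lossKraus_mul_diagonal_mul_conjTranspose_apply h0 h1 i _ hf]
  split_ifs
  · rw [Complex.ofReal_sum]
  · exact Finset.sum_const_zero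

theorem channel_map_loss_single (h0 : 0 ≤ t) (h1 : t ≤ 1) (s : Fock m K) {l : List (Fin m)}
    (hl : l.Nodup) :
    channel K t (l.map Element.loss) (Matrix.single s s 1) =
      Matrix.diagonal fun p => (survivalLaw t s.1 l.toFinset p.1 : ℂ) := by
  induction l using List.reverseRecOn with
  | nil =>
    simp only [List.map_nil, channel, List.foldl_nil, List.toFinset_nil, survivalLaw_empty,
      ← Matrix.diagonal_single, ← Subtype.ext_iff]
    congr 1
    ext p
    rw [Pi.single_apply]
    split_ifs <;> simp
  | append_singleton l i ih =>
    rw [List.nodup_append_comm, List.singleton_append, List.nodup_cons] at hl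
    rw [channel] at ih
    rw [List.map_append, channel, List.foldl_append, ih hl.2]
    simp only [List.map_singleton, List.foldl_cons, List.foldl_nil, Element.channel]
    rw [lossChannel_diagonal h0 h1 i
      fun q hq => survivalLaw_eq_zero_of_sum_lt t _ (s.2.trans_lt hq)]
    have hs : s.1 i ≤ K :=
      (Finset.single_le_sum (fun j _ => Nat.zero_le (s.1 j)) (Finset.mem_univ i)).trans s.2
    simp only [sum_choose_mul_survivalLaw_update (mt List.mem_toFinset.1 hl.1) hs,
      List.toFinset_append, List.toFinset_cons, List.toFinset_nil, Finset.union_insert,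
      Finset.union_empty]

theorem uniformLoss_single (h0 : 0 ≤ t) (h1 : t ≤ 1) (s : Fock m K) :
    uniformLoss K t (Matrix.single s s 1) =
      Matrix.diagonal fun p => ((∏ j, survivalProb t (s.1 j) (p.1 j) : ℝ) : ℂ) := by
  rw [uniformLoss, channel_map_loss_single h0 h1 s (List.nodup_finRange m), List.toFinset_finRange]
  simp only [survivalLaw_univ]

end LossOnFockStates

/-! ## The separable mixture against the lossy Fock state -/

section SepState

variable {m n l : ℕ}

theorem integral_angleLaw_exp {k : ℤ} (hk : k ≠ 0) :
    ∫ x, Complex.exp (k * Complex.I * (x : ℂ)) ∂angleLaw = 0 := by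
  have hperiod : (k : ℂ) * Complex.I * ((2 * Real.pi : ℝ) : ℂ) =
      k * (2 * Real.pi * Complex.I) := by
    push_cast
    ring
  rw [angleLaw_eq, integral_smul_measure, integral_Icc_eq_integral_Ioc,
    ← intervalIntegral.integral_of_le Real.two_pi_pos.le,
    integral_exp_mul_complex (mul_ne_zero (Int.cast_ne_zero.2 hk) Complex.I_ne_zero), hperiod,
    Complex.exp_int_mul_two_pi_mul_I]
  simp

theorem integral_angleLaw_pow_mul_conj_pow (c : ℝ) {a b : ℕ} (hab : a ≠ b) :
    ∫ x, (Complex.exp (-(Complex.I * (x : ℂ))) / (c : ℂ)) ^ a *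
      conj (Complex.exp (-(Complex.I * (x : ℂ))) / (c : ℂ)) ^ b ∂angleLaw = 0 := by
  have hexp (x : ℝ) : (Complex.exp (-(Complex.I * (x : ℂ))) / (c : ℂ)) ^ a *
        conj (Complex.exp (-(Complex.I * (x : ℂ))) / (c : ℂ)) ^ b =
      Complex.exp (((b - a : ℤ) : ℂ) * Complex.I * x) / (c : ℂ) ^ (a + b) := by
    rw [map_div₀, Complex.conj_ofReal, ← Complex.exp_conj, div_pow, div_pow, div_mul_div_comm,
      ← Complex.exp_nat_mul, ← Complex.exp_nat_mul, ← Complex.exp_add, ← pow_add]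
    congr 2
    simp only [map_neg, map_mul, Complex.conj_I, Complex.conj_ofReal]
    push_cast
    ring
  simp only [hexp]
  rw [integral_div, integral_angleLaw_exp (by omega), zero_div]

theorem integral_prod_phaseState_of_ne (hnm : n ≤ m) {p q : Fin m → ℕ} (hpq : p ≠ q) :
    ∫ φ, ∏ i, (phaseState m n φ i ^ p i * conj (phaseState m n φ i) ^ q i) ∂phaseLaw n = 0 := by
  obtain ⟨r, rfl⟩ := Nat.exists_eq_add_of_le hnm
  have hleft (φ : Fin n → ℝ) (k : Fin n) : phaseState (n + r) n φ (Fin.castAdd r k) =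
      Complex.exp (-(Complex.I * (φ k : ℂ))) / (Real.sqrt n : ℂ) := by
    simp [phaseState]
  have hright (φ : Fin n → ℝ) (k : Fin r) : phaseState (n + r) n φ (Fin.natAdd n k) = 0 := by
    simp [phaseState]
  simp only [Fin.prod_univ_add, hleft, hright]
  rw [integral_mul_const, phaseLaw, integral_fintype_prod_eq_prod (fun (k : Fin n) (x : ℝ) =>
    (Complex.exp (-(Complex.I * (x : ℂ))) / (Real.sqrt n : ℂ)) ^ p (Fin.castAdd r k) *
      conj (Complex.exp (-(Complex.I * (x : ℂ))) / (Real.sqrt n : ℂ)) ^ q (Fin.castAdd r k))]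
  obtain ⟨i, hi⟩ := Function.ne_iff.1 hpq
  induction i using Fin.addCases with
  | left k =>
    rw [Finset.prod_eq_zero (Finset.mem_univ k) (integral_angleLaw_pow_mul_conj_pow _ hi), zero_mul]
  | right k =>
    rw [Finset.prod_eq_zero (f := fun k : Fin r => (0 : ℂ) ^ p (Fin.natAdd n k) * _)
      (Finset.mem_univ k), mul_zero]
    rcases Nat.eq_zero_or_pos (p (Fin.natAdd n k)) with hp | hp
    · rw [map_zero, zero_pow (n := q _) (fun hq => hi (hp.trans hq.symm)), mul_zero]
    · rw [zero_pow hp.ne', zero_mul]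

theorem productOp_apply (K : ℕ) (v : Fin m → ℂ) (l : ℕ) (p q : Fock m K) :
    productOp K v l p q = if ∑ i, p.1 i = l ∧ ∑ i, q.1 i = l then
      l.factorial / (Real.sqrt (occFactorial p.1) * Real.sqrt (occFactorial q.1) : ℂ) *
        ∏ i, (v i ^ p.1 i * conj (v i) ^ q.1 i) else 0 := by
  rw [productOp_eq_smul_coherentOp, coherentOp_zero, Matrix.smul_apply, Matrix.vecMulVec_apply,
    Pi.star_apply, coherent, coherent, smul_eq_mul, ite_and]
  split_ifs
  · rw [RCLike.star_def, conj_coherentAmp, coherentAmp, coherentAmp, Finset.prod_mul_distrib]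
    simp only [Pi.star_apply, RCLike.star_def]
    ring
  all_goals simp

/-- The probability that `l` independent photons, each of them in a uniformly random mode among
the first `n`, have occupation numbers `p`: the diagonal entries of `sepState m n l`. -/
def sepWeight (n l : ℕ) (p : Fin m → ℕ) : ℝ :=
  if ∑ i, p i = l then
    l.factorial / occFactorial p * ∏ i, (if i.1 < n then (n : ℝ)⁻¹ else 0) ^ p i else 0

theorem sepWeight_nonneg (n l : ℕ) (p : Fin m → ℕ) : 0 ≤ sepWeight n l p := by
  have (i : Fin m) : 0 ≤ (if i.1 < n then (n : ℝ)⁻¹ else 0) := by positivity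
  unfold sepWeight
  positivity

theorem sepState_eq_diagonal (hnm : n ≤ m) (l : ℕ) :
    sepState m n l = Matrix.diagonal fun p : Fock m n => (sepWeight n l p.1 : ℂ) := by
  ext p q
  rw [sepState_apply]
  rcases eq_or_ne p q with rfl | hpq
  · have hmode (i : Fin m) : (if i.1 < n then (n : ℂ)⁻¹ else 0) =
        ((if i.1 < n then (n : ℝ)⁻¹ else 0 : ℝ) : ℂ) := by
      split_ifs <;> simp
    simp only [productOp_apply, ← mul_pow, phaseState_mul_conj, and_self, integral_const,
      probReal_univ, one_smul, Matrix.diagonal_apply_eq, sepWeight, sqrt_occFactorial_mul_self,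
      hmode]
    split_ifs <;> push_cast <;> rfl
  · rw [Matrix.diagonal_apply_ne _ hpq]
    simp only [productOp_apply]
    split_ifs
    · rw [integral_const_mul, integral_prod_phaseState_of_ne hnm (Subtype.coe_ne_coe.2 hpq),
        mul_zero]
    · exact integral_zero _ _

theorem trace_productOp {K : ℕ} (hl : l ≤ K) (v : Fin m → ℂ) :
    (productOp K v l).trace = (v ⬝ᵥ star v) ^ l := by
  rw [productOp_eq_smul_coherentOp, Matrix.trace_smul, trace_coherentOp hl, if_pos rfl, zero_add,
    smul_eq_mul, mul_div_cancel₀ _ (Nat.cast_ne_zero.2 l.factorial_ne_zero)]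

theorem trace_sepState (hnm : n ≤ m) (hl : l ≤ n) : (sepState m n l).trace = 1 := by
  have hnorm (φ : Fin n → ℝ) : (phaseState m n φ ⬝ᵥ star (phaseState m n φ)) ^ l = 1 := by
    rcases eq_or_ne n 0 with rfl | hn
    · rw [Nat.le_zero.1 hl, pow_zero]
    · rw [phaseState_dotProduct_star hnm hn, one_pow]
  have h := linearMap_sepState l (Matrix.traceLinearMap (Fock m n) ℂ ℂ)
  simpa only [Matrix.traceLinearMap_apply, trace_productOp hl, hnorm, integral_const,
    probReal_univ, one_smul] using h

theorem sum_sepWeight (hnm : n ≤ m) (hl : l ≤ n) : ∑ p : Fock m n, sepWeight n l p.1 = 1 := by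
  have h := trace_sepState hnm hl
  rw [sepState_eq_diagonal hnm, Matrix.trace_diagonal] at h
  exact_mod_cast h

end SepState

section Collisions

/-- The probability that `l` independent uniform choices among `n` possibilities are not pairwise
distinct (for `l ≤ n`, the subtraction being truncated). -/
def collisionProb (n l : ℕ) : ℝ :=
  1 - (n.factorial : ℝ) / ((n : ℝ) ^ l * ((n - l).factorial : ℝ))

variable {n l : ℕ}

theorem collisionProb_eq (hl : l ≤ n) :
    collisionProb n l = 1 - n.descFactorial l / (n : ℝ) ^ l := by
  rw [collisionProb, ← Nat.factorial_mul_descFactorial hl, mul_comm ((n : ℝ) ^ l), Nat.cast_mul,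
    mul_div_mul_left _ _ (Nat.cast_ne_zero.2 (Nat.factorial_ne_zero _))]

theorem descFactorial_div_pow_le_one (n l : ℕ) : (n.descFactorial l : ℝ) / (n : ℝ) ^ l ≤ 1 :=
  div_le_one_of_le₀ (by exact_mod_cast Nat.descFactorial_le_pow n l) (by positivity)

theorem collisionProb_nonneg (hl : l ≤ n) : 0 ≤ collisionProb n l := by
  rw [collisionProb_eq hl]
  exact sub_nonneg.2 (descFactorial_div_pow_le_one n l)

theorem one_sub_descFactorial_div_pow_le (hn : n ≠ 0) (l : ℕ) :
    1 - n.descFactorial l / (n : ℝ) ^ l ≤ (l : ℝ) * (l - 1) / (2 * n) := by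
  have : (0 : ℝ) < n := Nat.cast_pos.2 (Nat.pos_of_ne_zero hn)
  induction l with
  | zero => simp
  | succ l ih =>
    set x : ℝ := n.descFactorial l / (n : ℝ) ^ l with hx
    have hsub : (n : ℝ) - l ≤ (n - l : ℕ) := by
      rw [sub_le_iff_le_add]
      exact_mod_cast le_tsub_add
    have hstep : x - l / n ≤ (n.descFactorial (l + 1) : ℝ) / (n : ℝ) ^ (l + 1) :=
      calc x - l / n ≤ x - x * (l / n) :=
            sub_le_sub_left (mul_le_of_le_one_left (by positivity)
              (descFactorial_div_pow_le_one n l)) x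
        _ = x * ((n - l) / n) := by field_simp
        _ ≤ x * ((n - l : ℕ) / n) := by gcongr
        _ = _ := by
          rw [hx, Nat.descFactorial_succ, pow_succ, Nat.cast_mul]
          ring
    have hbound : ((l + 1 : ℕ) : ℝ) * ((l + 1 : ℕ) - 1) / (2 * n) =
        (l : ℝ) * (l - 1) / (2 * n) + l / n := by
      push_cast
      field_simp
      ring
    linarith

theorem sum_choose_mul_pow_mul_descFactorial_two (n : ℕ) (t : ℝ) :
    ∑ l ∈ Finset.range (n + 1), (n.choose l : ℝ) * t ^ l * (1 - t) ^ (n - l) *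
      ((l : ℝ) * (l - 1)) = n * (n - 1) * t ^ 2 := by
  have h := congrArg (Polynomial.eval t) (bernsteinPolynomial.sum_mul_smul ℝ n)
  have hcast (k : ℕ) : ((k * (k - 1) : ℕ) : ℝ) = (k : ℝ) * (k - 1) := by
    cases k <;> simp
  simp only [Polynomial.eval_finsetSum, nsmul_eq_mul, bernsteinPolynomial, Polynomial.eval_mul,
    Polynomial.eval_natCast, Polynomial.eval_pow, Polynomial.eval_X, Polynomial.eval_sub,
    Polynomial.eval_one, hcast] at h
  rw [← h]
  exact Finset.sum_congr rfl fun l _ => by ring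

theorem sum_choose_mul_collisionProb_le {t : ℝ} (h0 : 0 ≤ t) (h1 : t ≤ 1) (n : ℕ) :
    ∑ l ∈ Finset.range (n + 1), (n.choose l : ℝ) * t ^ l * (1 - t) ^ (n - l) *
      collisionProb n l ≤ t ^ 2 * n / 2 + t * (1 - t) / 2 := by
  have : 0 ≤ 1 - t := sub_nonneg.2 h1
  rcases eq_or_ne n 0 with rfl | hn
  · simp only [zero_add, Finset.range_one, Finset.sum_singleton, collisionProb, Nat.factorial_zero,
      zero_tsub, pow_zero, Nat.choose_self, Nat.cast_one, mul_one, div_one, sub_self,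
      Nat.cast_zero, mul_zero, zero_div]
    positivity
  calc _ ≤ ∑ l ∈ Finset.range (n + 1), (n.choose l : ℝ) * t ^ l * (1 - t) ^ (n - l) *
        ((l : ℝ) * (l - 1) / (2 * n)) := by
        refine Finset.sum_le_sum fun l hl => mul_le_mul_of_nonneg_left ?_ (by positivity)
        rw [collisionProb_eq (Nat.lt_succ_iff.1 (Finset.mem_range.1 hl))]
        exact one_sub_descFactorial_div_pow_le hn l
    _ = n * (n - 1) * t ^ 2 / (2 * n) := by
        rw [← sum_choose_mul_pow_mul_descFactorial_two, Finset.sum_div]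
        exact Finset.sum_congr rfl fun l _ => by ring
    _ = t ^ 2 * n / 2 - t ^ 2 / 2 := by field_simp
    _ ≤ _ := by nlinarith

end Collisions

section SepDist

variable {m n K : ℕ} {t : ℝ}

theorem standardOcc_le_one (i : Fin m) : (standardOcc m n).1 i ≤ 1 := by
  simp only [standardOcc]
  split_ifs <;> simp

theorem sum_standardOcc (hnm : n ≤ m) : ∑ i, (standardOcc m n).1 i = n := by
  simp only [standardOcc]
  rw [Finset.sum_boole, Fin.card_filter_val_lt, min_eq_right hnm, Nat.cast_id]

theorem sum_fock_le {M : Type*} [AddCommMonoid M] (f : ℕ → M) {s : Fock m K}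
    (hs : ∀ i, s.1 i ≤ 1) :
    ∑ p : Fock m K with ∀ i, p.1 i ≤ s.1 i, f (∑ i, p.1 i) =
      ∑ l ∈ Finset.range (∑ i, s.1 i + 1), (∑ i, s.1 i).choose l • f l := by
  set support : Fock m K → Finset (Fin m) := fun p => Finset.univ.filter fun i => p.1 i = 1
  have hindicator {p : Fock m K} (hp : ∀ i, p.1 i ≤ s.1 i) (i : Fin m) :
      p.1 i = if i ∈ support p then 1 else 0 := by
    have := (hp i).trans (hs i)
    simp only [support, Finset.mem_filter, Finset.mem_univ, true_and]
    split_ifs <;> omega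
  have hcard {p : Fock m K} (hp : ∀ i, p.1 i ≤ s.1 i) : ∑ i, p.1 i = (support p).card := by
    simp only [Finset.sum_congr rfl fun i _ => hindicator hp i, Finset.sum_boole,
      Finset.filter_mem_eq_inter, Finset.univ_inter, Nat.cast_id]
  rw [hcard fun i => le_rfl, ← Finset.sum_powerset_apply_card f]
  refine Finset.sum_nbij support (fun p hp => ?_) (fun p hp q hq hpq => ?_) (fun S hS => ?_)
    (fun p hp => by rw [hcard (Finset.mem_filter.1 hp).2])
  · refine Finset.mem_powerset.2 fun i hi => ?_
    have := (Finset.mem_filter.1 hp).2 i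
    have := hs i
    simp only [support, Finset.mem_filter, Finset.mem_univ, true_and] at hi ⊢
    omega
  · have hp' := (Finset.mem_filter.1 (Finset.mem_coe.1 hp)).2
    have hq' := (Finset.mem_filter.1 (Finset.mem_coe.1 hq)).2
    exact Subtype.ext (funext fun i => by rw [hindicator hp', hindicator hq', hpq])
  · have hle (i : Fin m) : (if i ∈ S then 1 else 0) ≤ s.1 i := by
      split_ifs with hi
      · exact (Finset.mem_filter.1 (Finset.mem_powerset.1 (Finset.mem_coe.1 hS) hi)).2.ge
      · exact Nat.zero_le _
    refine ⟨⟨fun i => if i ∈ S then 1 else 0, (Finset.sum_le_sum fun i _ => hle i).trans s.2⟩,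
      Finset.mem_coe.2 (Finset.mem_filter.2 ⟨Finset.mem_univ _, hle⟩), ?_⟩
    ext i
    simp [support]

theorem prod_survivalProb_of_le_one (t : ℝ) {s : Fin m → ℕ} (hs : ∀ i, s i ≤ 1)
    (p : Fin m → ℕ) :
    ∏ i, survivalProb t (s i) (p i) =
      if ∀ i, p i ≤ s i then t ^ (∑ i, p i) * (1 - t) ^ (∑ i, s i - ∑ i, p i) else 0 := by
  split_ifs with h
  · rw [← Finset.sum_tsub_distrib _ fun i _ => h i, ← Finset.prod_pow_eq_pow_sum,
      ← Finset.prod_pow_eq_pow_sum, ← Finset.prod_mul_distrib]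
    refine Finset.prod_congr rfl fun i _ => ?_
    have hchoose : (s i).choose (p i) = 1 := by
      rcases Nat.le_one_iff_eq_zero_or_eq_one.1 ((h i).trans (hs i)) with hp | hp
      · rw [hp, Nat.choose_zero_right]
      · rw [hp, (hs i).antisymm (hp ▸ h i), Nat.choose_self]
    rw [survivalProb, hchoose, Nat.cast_one, one_mul]
  · obtain ⟨i, hi⟩ := not_forall.1 h
    refine Finset.prod_eq_zero (Finset.mem_univ i) ?_
    rw [survivalProb, Nat.choose_eq_zero_of_lt (not_le.1 hi), Nat.cast_zero, zero_mul, zero_mul]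

theorem half_mul_sum_abs_eq {α : Type*} [Fintype α] {d : α → ℝ} (hd : ∑ x, d x = 0)
    (P : α → Prop) [DecidablePred P] (hneg : ∀ x, P x → d x ≤ 0) (hpos : ∀ x, ¬P x → 0 ≤ d x) :
    (1 / 2) * ∑ x, |d x| = ∑ x with P x, -d x := by
  have habs (x : α) : |d x| = d x + 2 * if P x then -d x else 0 := by
    split_ifs with h
    · rw [abs_of_nonpos (hneg x h)]
      ring
    · rw [abs_of_nonneg (hpos x h)]
      ring
  simp only [habs, Finset.sum_add_distrib, hd, ← Finset.mul_sum, Finset.sum_filter]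
  ring

/-- The diagonal entries of the difference of the separable mixture and the lossy Fock state, see
`sepMixture_sub_uniformLoss`. -/
def sepDiff (n : ℕ) (t : ℝ) (p : Fock m n) : ℝ :=
  (∑ l ∈ Finset.range (n + 1), ((n.choose l : ℝ) * t ^ l * (1 - t) ^ (n - l)) *
    sepWeight n l p.1) - ∏ i, survivalProb t ((standardOcc m n).1 i) (p.1 i)

theorem sepMixture_sub_uniformLoss (hnm : n ≤ m) (h0 : 0 ≤ t) (h1 : t ≤ 1) :
    sepMixture m n t - uniformLoss n t (inputState m n) =
      Matrix.diagonal fun p => (sepDiff n t p : ℂ) := by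
  rw [sepMixture, inputState, uniformLoss_single h0 h1]
  simp only [sepState_eq_diagonal hnm]
  ext p q
  simp only [Matrix.sub_apply, Matrix.sum_apply, Matrix.smul_apply, Matrix.diagonal_apply, sepDiff]
  split_ifs
  · push_cast
    rfl
  · simp

theorem sum_sepDiff (hnm : n ≤ m) (t : ℝ) : ∑ p : Fock m n, sepDiff n t p = 0 := by
  simp only [sepDiff, Finset.sum_sub_distrib, prod_survivalProb_of_le_one t standardOcc_le_one]
  rw [Finset.sum_comm, ← Finset.sum_filter, sum_standardOcc hnm,
    sum_fock_le (fun l => t ^ l * (1 - t) ^ (n - l)) standardOcc_le_one, sum_standardOcc hnm,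
    sub_eq_zero]
  refine Finset.sum_congr rfl fun l hl => ?_
  rw [← Finset.mul_sum, sum_sepWeight hnm (Nat.lt_succ_iff.1 (Finset.mem_range.1 hl)),
    nsmul_eq_mul]
  ring

theorem sepWeight_of_le_standardOcc {p : Fock m n} (hp : ∀ i, p.1 i ≤ (standardOcc m n).1 i)
    (l : ℕ) :
    sepWeight n l p.1 = if ∑ i, p.1 i = l then l.factorial / (n : ℝ) ^ l else 0 := by
  have hocc : occFactorial p.1 = 1 :=
    Finset.prod_eq_one fun i _ => Nat.factorial_eq_one.2 ((hp i).trans (standardOcc_le_one i))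
  rw [sepWeight]
  split_ifs with hl
  · have hprod : ∏ i, (if i.1 < n then (n : ℝ)⁻¹ else 0) ^ p.1 i = ((n : ℝ) ^ l)⁻¹ := by
      rw [← hl, ← inv_pow, ← Finset.prod_pow_eq_pow_sum]
      refine Finset.prod_congr rfl fun i _ => ?_
      have := hp i
      simp only [standardOcc] at this
      split_ifs at this ⊢ with hi
      · rfl
      · rw [Nat.le_zero.1 this, pow_zero, pow_zero]
    rw [hocc, hprod, Nat.cast_one, div_one, div_eq_mul_inv]
  · rfl

theorem neg_sepDiff_of_le_standardOcc (hnm : n ≤ m) (t : ℝ) {p : Fock m n}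
    (hp : ∀ i, p.1 i ≤ (standardOcc m n).1 i) :
    -sepDiff n t p =
      t ^ (∑ i, p.1 i) * (1 - t) ^ (n - ∑ i, p.1 i) * collisionProb n (∑ i, p.1 i) := by
  have hchoose : (n.choose (∑ i, p.1 i) : ℝ) * (∑ i, p.1 i).factorial =
      n.descFactorial (∑ i, p.1 i) := by
    rw [Nat.descFactorial_eq_factorial_mul_choose, Nat.cast_mul, mul_comm]
  rw [sepDiff, prod_survivalProb_of_le_one t standardOcc_le_one, if_pos hp, sum_standardOcc hnm,
    collisionProb_eq p.2, ← hchoose]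
  simp only [sepWeight_of_le_standardOcc hp, mul_ite, mul_zero, Finset.sum_ite_eq,
    Finset.mem_range_succ_iff, p.2, if_true]
  ring

theorem sepDist_eq (hnm : n ≤ m) (h0 : 0 ≤ t) (h1 : t ≤ 1) :
    sepDist m n t = ∑ l ∈ Finset.range (n + 1),
      (n.choose l : ℝ) * t ^ l * (1 - t) ^ (n - l) * collisionProb n l := by
  have : 0 ≤ 1 - t := sub_nonneg.2 h1
  have hneg (p : Fock m n) (hp : ∀ i, p.1 i ≤ (standardOcc m n).1 i) : sepDiff n t p ≤ 0 := by
    have := collisionProb_nonneg p.2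
    rw [← neg_nonneg, neg_sepDiff_of_le_standardOcc hnm t hp]
    positivity
  have hpos (p : Fock m n) (hp : ¬∀ i, p.1 i ≤ (standardOcc m n).1 i) : 0 ≤ sepDiff n t p := by
    rw [sepDiff, prod_survivalProb_of_le_one t standardOcc_le_one, if_neg hp, sub_zero]
    exact Finset.sum_nonneg fun l _ => mul_nonneg (by positivity) (sepWeight_nonneg n l p.1)
  rw [sepDist, traceDist_of_sub_eq_diagonal (sepMixture_sub_uniformLoss hnm h0 h1),
    half_mul_sum_abs_eq (sum_sepDiff hnm t) _ hneg hpos,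
    Finset.sum_congr rfl fun p hp =>
      neg_sepDiff_of_le_standardOcc hnm t (Finset.mem_filter.1 hp).2,
    sum_fock_le (fun l => t ^ l * (1 - t) ^ (n - l) * collisionProb n l) standardOcc_le_one,
    sum_standardOcc hnm]
  refine Finset.sum_congr rfl fun l _ => ?_
  rw [nsmul_eq_mul]
  ring

theorem sepDist_le (hnm : n ≤ m) (h0 : 0 ≤ t) (h1 : t ≤ 1) :
    sepDist m n t ≤ t ^ 2 * n / 2 + t * (1 - t) / 2 :=
  (sepDist_eq hnm h0 h1).trans_le (sum_choose_mul_collisionProb_le h0 h1 n)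

theorem tvDist_channel_le_sepDist (hnm : n ≤ m) {η : ℝ} (hη0 : 0 ≤ η) (hη1 : η ≤ 1)
    (h0 : 0 ≤ t) (h1 : t ≤ 1) (L : List (Element m)) :
    tvDist (outputDist (channel n η L (uniformLoss n t (inputState m n))))
      (outputDist (channel n η L (sepMixture m n t))) ≤ sepDist m n t := by
  rw [tvDist_comm, sepDist, traceDist_of_sub_eq_diagonal (sepMixture_sub_uniformLoss hnm h0 h1)]
  exact tvDist_channel_le hη0 hη1 L (sepMixture_sub_uniformLoss hnm h0 h1)

end SepDist

/-! ## Reasoning about programs -/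

section Runs

variable {ω : ℕ → unitInterval} {b : Test} {c d : Cmd} {B B' : ℕ} {P Q R : Store → Prop}

/-- Total-correctness triple with a time bound: started in a store satisfying `P`, the program `c`
halts within `B` steps in a store satisfying `Q`. -/
def Runs (ω : ℕ → unitInterval) (c : Cmd) (B : ℕ) (P Q : Store → Prop) : Prop :=
  ∀ st, P st → ∃ t ≤ B, ∃ st', Exec ω c st t st' ∧ Q st'

namespace Runs

theorem seq (hc : Runs ω c B P Q) (hd : Runs ω d B' Q R) : Runs ω (.seq c d) (B + B') P R := by
  intro st hP
  obtain ⟨t, ht, st', hexec, hQ⟩ := hc st hP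
  obtain ⟨t', ht', st'', hexec', hR⟩ := hd st' hQ
  exact ⟨t + t', add_le_add ht ht', st'', .seq hexec hexec', hR⟩

theorem loop {n : ℕ} (I : ℕ → Store → Prop) (htest : ∀ k st, I k st → (b.holds st ↔ k < n))
    (hbody : ∀ k < n, Runs ω c B (I k) (I (k + 1))) :
    Runs ω (.loop b c) (n * (b.cost + B) + b.cost) (I 0) (I n) := by
  suffices ∀ r k, k + r = n → Runs ω (.loop b c) (r * (b.cost + B) + b.cost) (I k) (I n) from
    this n 0 (zero_add n)
  intro r
  induction r with
  | zero =>
    rintro k rfl st hI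
    exact ⟨b.cost, (zero_mul (b.cost + B)).symm ▸ (zero_add b.cost).ge, st,
      .loopDone ((htest k st hI).not.2 (lt_irrefl k)), hI⟩
  | succ r ih =>
    intro k hk st hI
    obtain ⟨t, ht, st', hexec, hI'⟩ := hbody k (by omega) st hI
    obtain ⟨t', ht', st'', hexec', hn⟩ := ih (k + 1) (by omega) st' hI'
    refine ⟨b.cost + t + t', ?_, st'', .loopStep ((htest k st hI).2 (by omega)) hexec hexec', hn⟩
    calc b.cost + t + t' ≤ b.cost + B + (r * (b.cost + B) + b.cost) := by gcongr
      _ = (r + 1) * (b.cost + B) + b.cost := by ring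

end Runs

end Runs

namespace Store

variable (st : Store) (a k a' k' : ℕ)

@[simp] theorem nat_writeN (v : ℕ) :
    (st.writeN a k v).nat a' k' = if a' = a ∧ k' = k then v else st.nat a' k' := by
  simp only [writeN, Function.update_apply]
  split_ifs <;> simp_all

@[simp] theorem real_writeR (x : ℝ) :
    (st.writeR a k x).real a' k' = if a' = a ∧ k' = k then x else st.real a' k' := by
  simp only [writeR, Function.update_apply]
  split_ifs <;> simp_all

@[simp] theorem real_writeN (v : ℕ) : (st.writeN a k v).real = st.real := rfl

@[simp] theorem nat_writeR (x : ℝ) : (st.writeR a k x).nat = st.nat := rfl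

@[simp] theorem used_writeN (v : ℕ) : (st.writeN a k v).used = st.used := rfl

@[simp] theorem used_writeR (x : ℝ) : (st.writeR a k x).used = st.used := rfl

@[simp] theorem nat_tick : st.tick.nat = st.nat := rfl

@[simp] theorem real_tick : st.tick.real = st.real := rfl

@[simp] theorem used_tick : st.tick.used = st.used + 1 := rfl

theorem writeN_self : st.writeN a k (st.nat a k) = st := by
  simp [writeN]

end Store

/-! ## The sampling program -/

namespace Sampler

/-- Number of modes, part of the input. -/
abbrev modes : NExp := .get 0 (.const 0)

/-- Number of photons, part of the input. -/
abbrev photons : NExp := .get 0 (.const 1)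

/-- Number of blocks, part of the input. -/
abbrev blocks : NExp := .get 0 (.const 2)

/-- Counter of the phases drawn, then of the blocks applied, then of the photons detected. -/
abbrev outer : NExp := .get 4 (.const 0)

/-- Counter of the modes compared with the current photon. -/
abbrev inner : NExp := .get 4 (.const 1)

/-- Temporary real cell. During the detection of a photon, cell `0` holds its random number, and
cells `1` and `2` the ends of the detection interval of the current mode; during the application of
a block, cells `3, …, 6` hold the new amplitudes. -/
abbrev temp (k : ℕ) : RExp := .get 11 (.const k)

/-- Advance the outer counter. -/
def nextOuter : Cmd := .setN 4 (.const 0) (.add outer (.const 1))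

/-- Reset the outer counter. -/
def resetOuter : Cmd := .setN 4 (.const 0) (.const 0)

/-- Draw one phase `θ` and store the amplitude `exp (-i θ) / √n`, its real part in array `9` and its
imaginary part in array `10`. -/
def phaseBody : Cmd :=
  .seq (.phase 9 outer 10 outer) <|
  .seq (.setR 9 outer (.div (.get 9 outer) (.sqrt (.ofNat photons)))) <|
  .seq (.setR 10 outer (.div (.sub (.const 0) (.get 10 outer)) (.sqrt (.ofNat photons))))
  nextOuter

/-- Real part of a row of the current lossy block applied to the amplitudes; the arrays
`a, …, a + 3` hold the row. -/
def rowRe (a : ℕ) : RExp :=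
  .mul (.sqrt (.get 0 (.const 0)))
    (.add (.sub (.mul (.get a outer) (.get 9 (.get 1 outer)))
        (.mul (.get (a + 1) outer) (.get 10 (.get 1 outer))))
      (.sub (.mul (.get (a + 2) outer) (.get 9 (.get 2 outer)))
        (.mul (.get (a + 3) outer) (.get 10 (.get 2 outer)))))

/-- Imaginary part of a row of the current lossy block applied to the amplitudes; the arrays
`a, …, a + 3` hold the row. -/
def rowIm (a : ℕ) : RExp :=
  .mul (.sqrt (.get 0 (.const 0)))
    (.add (.add (.mul (.get a outer) (.get 10 (.get 1 outer)))
        (.mul (.get (a + 1) outer) (.get 9 (.get 1 outer))))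
      (.add (.mul (.get (a + 2) outer) (.get 10 (.get 2 outer)))
        (.mul (.get (a + 3) outer) (.get 9 (.get 2 outer)))))

/-- Apply one lossy block to the amplitudes. -/
def blockBody : Cmd :=
  .seq (.setR 11 (.const 3) (rowRe 1)) <|
  .seq (.setR 11 (.const 4) (rowIm 1)) <|
  .seq (.setR 11 (.const 5) (rowRe 5)) <|
  .seq (.setR 11 (.const 6) (rowIm 5)) <|
  .seq (.setR 9 (.get 1 outer) (temp 3)) <|
  .seq (.setR 10 (.get 1 outer) (temp 4)) <|
  .seq (.setR 9 (.get 2 outer) (temp 5)) <|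
  .seq (.setR 10 (.get 2 outer) (temp 6))
  nextOuter

/-- Draw the random number of one photon and return to the first mode. -/
def drawPhoton : Cmd :=
  .seq (.uniform 11 (.const 0)) <|
  .seq (.setN 4 (.const 1) (.const 0))
  (.setR 11 (.const 1) (.const 0))

/-- Right end of the detection interval of the current mode. -/
def nextCumul : RExp :=
  .add (temp 1) (.add (.mul (.get 9 inner) (.get 9 inner)) (.mul (.get 10 inner) (.get 10 inner)))

/-- Record a photon in the current mode if its random number lies in the detection interval. -/
def detectTest : Cmd :=
  .ite (.ltR (temp 0) (temp 1)) .skip <|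
  .ite (.ltR (temp 0) (temp 2)) (.setN 3 inner (.add (.get 3 inner) (.const 1))) .skip

/-- Compare the current photon with one mode. -/
def detectBody : Cmd :=
  .seq (.setR 11 (.const 2) nextCumul) <|
  .seq detectTest <|
  .seq (.setR 11 (.const 1) (temp 2))
  (.setN 4 (.const 1) (.add inner (.const 1)))

/-- Detect one photon. -/
def photonBody : Cmd :=
  .seq drawPhoton (.seq (.loop (.ltN inner modes) detectBody) nextOuter)

/-- The sampler: draw the phases of a single-particle state, propagate its amplitudes through the
network, and distribute the photons independently over the modes according to the resulting
weights. -/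
def program : Cmd :=
  .seq (.loop (.ltN outer photons) phaseBody) <|
  .seq resetOuter <|
  .seq (.loop (.ltN outer blocks) blockBody) <|
  .seq resetOuter
  (.loop (.ltN outer photons) photonBody)

/-! ## Correctness of the sampling program -/

section Intact

variable {m n : ℕ} {η : ℝ} {N : Network m} {st : Store}

/-- The arrays that hold the input are unchanged. -/
structure Intact {m : ℕ} (n : ℕ) (η : ℝ) (N : Network m) (st : Store) : Prop where
  nat_eq : ∀ a < 3, ∀ k, st.nat a k = (inputStore n η N).nat a k
  real_eq : ∀ a < 9, ∀ k, st.real a k = (inputStore n η N).real a k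

namespace Intact

theorem modes (h : Intact n η N st) : st.nat 0 0 = m := h.nat_eq 0 (by norm_num) 0

theorem photons (h : Intact n η N st) : st.nat 0 1 = n := h.nat_eq 0 (by norm_num) 1

theorem blocks (h : Intact n η N st) : st.nat 0 2 = N.length := h.nat_eq 0 (by norm_num) 2

theorem transmissivity (h : Intact n η N st) : st.real 0 0 = η := h.real_eq 0 (by norm_num) 0

theorem fst (h : Intact n η N st) {k : ℕ} (hk : k < N.length) : st.nat 1 k = N[k].fst := by
  simp [h.nat_eq, inputStore, hk]

theorem snd (h : Intact n η N st) {k : ℕ} (hk : k < N.length) : st.nat 2 k = N[k].snd := by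
  simp [h.nat_eq, inputStore, hk]

theorem entry_eq (h : Intact n η N st) {k : ℕ} (hk : k < N.length) (i j : Fin 2) :
    (⟨st.real (1 + 4 * i + 2 * j) k, st.real (1 + 4 * i + 2 * j + 1) k⟩ : ℂ) = N[k].u.1 i j := by
  fin_cases i <;> fin_cases j <;> simp [h.real_eq, inputStore, hk]

theorem writeN (h : Intact n η N st) {a : ℕ} (ha : 3 ≤ a) (k v : ℕ) :
    Intact n η N (st.writeN a k v) where
  nat_eq a' ha' k' := by rw [Store.nat_writeN, if_neg (by omega), h.nat_eq a' ha']
  real_eq := h.real_eq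

theorem writeR (h : Intact n η N st) {a : ℕ} (ha : 9 ≤ a) (k : ℕ) (x : ℝ) :
    Intact n η N (st.writeR a k x) where
  nat_eq := h.nat_eq
  real_eq a' ha' k' := by rw [Store.real_writeR, if_neg (by omega), h.real_eq a' ha']

theorem tick (h : Intact n η N st) : Intact n η N st.tick := ⟨h.nat_eq, h.real_eq⟩

end Intact

end Intact

/-- The amplitude stored for a mode. -/
def amp (st : Store) (i : ℕ) : ℂ := ⟨st.real 9 i, st.real 10 i⟩

theorem amp_writeN (st : Store) (a k v : ℕ) : amp (st.writeN a k v) = amp st := rfl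

theorem amp_tick (st : Store) : amp st.tick = amp st := rfl

theorem amp_writeR (st : Store) {a : ℕ} (ha : 11 ≤ a) (k : ℕ) (x : ℝ) :
    amp (st.writeR a k x) = amp st := by
  ext i
  simp [amp, show 9 ≠ a ∧ 10 ≠ a by omega]

section PhaseLoop

variable {m n : ℕ} {η : ℝ} {N : Network m} {ω : ℕ → unitInterval}

/-- Invariant of the first loop: the first `k` amplitudes have been drawn. -/
structure PhaseInv {m : ℕ} (n : ℕ) (η : ℝ) (N : Network m) (ω : ℕ → unitInterval) (k : ℕ)
    (st : Store) : Prop where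
  intact : Intact n η N st
  count_eq : ∀ i, st.nat 3 i = 0
  outer_eq : st.nat 4 0 = k
  used_eq : st.used = k
  amp_eq : ∀ i, amp st i =
    if i < k then Complex.exp (-(Complex.I * (2 * Real.pi * ω i : ℝ))) / (Real.sqrt n : ℂ) else 0

theorem exp_neg_I_mul_div_ofReal (θ x : ℝ) :
    Complex.exp (-(Complex.I * θ)) / x = ⟨Real.cos θ / x, (0 - Real.sin θ) / x⟩ := by
  rw [mul_comm, ← neg_mul, ← Complex.ofReal_neg]
  apply Complex.ext
  · rw [Complex.div_ofReal_re, Complex.exp_ofReal_mul_I_re, Real.cos_neg]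
  · rw [Complex.div_ofReal_im, Complex.exp_ofReal_mul_I_im, Real.sin_neg, zero_sub]

theorem runs_phaseBody (k : ℕ) :
    Runs ω phaseBody 40 (PhaseInv n η N ω k) (PhaseInv n η N ω (k + 1)) := by
  rintro st ⟨hintact, hcount, houter, hused, hamp⟩
  refine ⟨_, ?_, _, .seq (.phase _ _ _ _ _) (.seq (.setR _ _ _ _) (.seq (.setR _ _ _ _)
    (.setN _ _ _ _))), ?_, fun i => ?_, ?_, ?_, fun i => ?_⟩
  · simp [NExp.cost, RExp.cost]
  · exact ((((hintact.writeR (by norm_num) _ _).writeR (by norm_num) _ _).tick.writeR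
      (by norm_num) _ _).writeR (by norm_num) _ _).writeN (by norm_num) _ _
  · simp [hcount]
  · simp [NExp.eval, houter]
  · simp [hused]
  · have hold := hamp i
    rw [amp] at hold
    rcases eq_or_ne i k with rfl | hik
    · rw [if_pos i.lt_succ_self, exp_neg_I_mul_div_ofReal]
      simp [amp, NExp.eval, RExp.eval, houter, hused, hintact.photons]
    · have hlt : i < k + 1 ↔ i < k := by omega
      simp only [hlt, ← hold]
      simp [amp, NExp.eval, houter, hik]

theorem phaseInv_inputStore : PhaseInv n η N ω 0 (inputStore n η N) where
  intact := ⟨fun _ _ _ => rfl, fun _ _ _ => rfl⟩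
  count_eq _ := rfl
  outer_eq := rfl
  used_eq := rfl
  amp_eq _ := rfl

theorem runs_phaseLoop :
    Runs ω (.loop (.ltN outer photons) phaseBody) (n * (5 + 40) + 5) (PhaseInv n η N ω 0)
      (PhaseInv n η N ω n) :=
  Runs.loop _ (fun _ _ h => by simp [Test.holds, NExp.eval, h.outer_eq, h.intact.photons])
    fun k _ => runs_phaseBody k

end PhaseLoop

section BlockLoop

variable {m n : ℕ} {η : ℝ} {N : Network m} {ω : ℕ → unitInterval} {st : Store}

/-- Invariant of the second loop: the first `k` blocks have been applied to the amplitudes `v`. -/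
structure BlockInv {m : ℕ} (n : ℕ) (η : ℝ) (N : Network m) (v : Fin m → ℂ) (k : ℕ)
    (st : Store) : Prop where
  intact : Intact n η N st
  count_eq : ∀ i, st.nat 3 i = 0
  outer_eq : st.nat 4 0 = k
  used_eq : st.used = n
  amp_eq : ∀ i : Fin m, amp st i = (transfer η (Network.elements (N.take k)) *ᵥ v) i

theorem transfer_elements_append (η : ℝ) (N N' : Network m) :
    transfer η (Network.elements (N ++ N')) = transfer η N'.elements * transfer η N.elements := by
  rw [Network.elements, List.flatMap_append, transfer_append, ← Network.elements,
    ← Network.elements]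

theorem transfer_elements_singleton_mulVec (η : ℝ) (g : Beamsplitter m) (v : Fin m → ℂ)
    (i : Fin m) :
    (transfer η (Network.elements [g]) *ᵥ v) i =
      if i = g.fst then (Real.sqrt η : ℂ) * (g.u.1 0 0 * v g.fst + g.u.1 0 1 * v g.snd)
      else if i = g.snd then (Real.sqrt η : ℂ) * (g.u.1 1 0 * v g.fst + g.u.1 1 1 * v g.snd)
      else v i := by
  have htransfer : transfer η (Network.elements [g]) =
      g.matrix * lossMatrix η g.snd * lossMatrix η g.fst := by
    simp [Network.elements, transfer, Element.transfer]
  rw [htransfer, ← Matrix.mulVec_mulVec, ← Matrix.mulVec_mulVec]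
  split_ifs with hfst hsnd
  · rw [hfst, g.matrix_mulVec_fst]
    simp only [lossMatrix_mulVec, g.ne, g.ne.symm, if_true, if_false]
    ring
  · rw [hsnd, g.matrix_mulVec_snd]
    simp only [lossMatrix_mulVec, g.ne, g.ne.symm, if_true, if_false]
    ring
  · rw [g.matrix_mulVec_of_ne _ hfst hsnd]
    simp only [lossMatrix_mulVec, hfst, hsnd, if_false, one_mul]

theorem rowRe_rowIm_eval (st : Store) (a : ℕ) :
    (⟨(rowRe a).eval st, (rowIm a).eval st⟩ : ℂ) = (Real.sqrt (st.real 0 0) : ℂ) *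
      (⟨st.real a (st.nat 4 0), st.real (a + 1) (st.nat 4 0)⟩ * amp st (st.nat 1 (st.nat 4 0)) +
        ⟨st.real (a + 2) (st.nat 4 0), st.real (a + 3) (st.nat 4 0)⟩ *
          amp st (st.nat 2 (st.nat 4 0))) := by
  apply Complex.ext <;> simp [rowRe, rowIm, RExp.eval, NExp.eval, amp]

theorem rowRe_eval_writeR {a : ℕ} (ha : a < 8) (st : Store) (k : ℕ) (x : ℝ) :
    (rowRe a).eval (st.writeR 11 k x) = (rowRe a).eval st := by
  simp [rowRe, RExp.eval, NExp.eval, show a ≠ 11 ∧ a ≠ 10 ∧ a ≠ 9 ∧ a ≠ 8 by omega]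

theorem rowIm_eval_writeR {a : ℕ} (ha : a < 8) (st : Store) (k : ℕ) (x : ℝ) :
    (rowIm a).eval (st.writeR 11 k x) = (rowIm a).eval st := by
  simp [rowIm, RExp.eval, NExp.eval, show a ≠ 11 ∧ a ≠ 10 ∧ a ≠ 9 ∧ a ≠ 8 by omega]

theorem exec_blockBody (h : Intact n η N st) (hne : st.nat 1 (st.nat 4 0) ≠ st.nat 2 (st.nat 4 0)) :
    ∃ t ≤ 500, ∃ st', Exec ω blockBody st t st' ∧ Intact n η N st' ∧
      st'.nat 3 = st.nat 3 ∧ st'.nat 4 0 = st.nat 4 0 + 1 ∧ st'.used = st.used ∧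
      ∀ i, amp st' i =
        if i = st.nat 1 (st.nat 4 0) then ⟨(rowRe 1).eval st, (rowIm 1).eval st⟩
        else if i = st.nat 2 (st.nat 4 0) then ⟨(rowRe 5).eval st, (rowIm 5).eval st⟩
        else amp st i := by
  refine ⟨_, ?_, _, .seq (.setR _ _ _ _) (.seq (.setR _ _ _ _) (.seq (.setR _ _ _ _)
    (.seq (.setR _ _ _ _) (.seq (.setR _ _ _ _) (.seq (.setR _ _ _ _) (.seq (.setR _ _ _ _)
    (.seq (.setR _ _ _ _) (.setN _ _ _ _)))))))), ?_, ?_, ?_, ?_, fun i => ?_⟩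
  · simp [NExp.cost, RExp.cost, rowRe, rowIm]
  · repeat' first | exact h | apply Intact.writeN | apply Intact.writeR | norm_num
  · ext; simp
  · simp [NExp.eval]
  · rfl
  · simp only [rowRe_eval_writeR, rowIm_eval_writeR, Nat.reduceLT]
    rcases eq_or_ne i (st.nat 1 (st.nat 4 0)) with rfl | hi
    · simp [amp, RExp.eval, NExp.eval, hne]
    · rcases eq_or_ne i (st.nat 2 (st.nat 4 0)) with rfl | hi'
      · simp [amp, RExp.eval, NExp.eval, hi]
      · simp [amp, RExp.eval, NExp.eval, hi, hi']

theorem runs_blockBody (v : Fin m → ℂ) {k : ℕ} (hk : k < N.length) :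
    Runs ω blockBody 500 (BlockInv n η N v k) (BlockInv n η N v (k + 1)) := by
  rintro st ⟨hintact, hcount, houter, hused, hamp⟩
  have hfst := hintact.fst hk
  have hsnd := hintact.snd hk
  have hne : N[k].fst.1 ≠ N[k].snd.1 := fun h => N[k].ne (Fin.ext h)
  obtain ⟨t, ht, st', hexec, hintact', hcount', houter', hused', hamp'⟩ :=
    exec_blockBody (ω := ω) hintact (by rw [houter, hfst, hsnd]; exact hne)
  refine ⟨t, ht, st', hexec, hintact', by simp [hcount', hcount], by rw [houter', houter],
    by rw [hused', hused], fun i => ?_⟩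
  rw [hamp', List.take_succ_eq_append_getElem hk, transfer_elements_append,
    ← Matrix.mulVec_mulVec, transfer_elements_singleton_mulVec, ← hamp, ← hamp, ← hamp,
    rowRe_rowIm_eval, rowRe_rowIm_eval, houter, hfst, hsnd, hintact.transmissivity,
    ← hintact.entry_eq hk, ← hintact.entry_eq hk, ← hintact.entry_eq hk, ← hintact.entry_eq hk]
  simp only [Fin.ext_iff, Fin.isValue, Fin.val_zero, Fin.val_one, mul_zero, mul_one, add_zero,
    Nat.reduceAdd]

theorem runs_blockLoop (v : Fin m → ℂ) :
    Runs ω (.loop (.ltN outer blocks) blockBody) (N.length * (5 + 500) + 5) (BlockInv n η N v 0)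
      (BlockInv n η N v N.length) :=
  Runs.loop _ (fun _ _ h => by simp [Test.holds, NExp.eval, h.outer_eq, h.intact.blocks])
    fun _ hk => runs_blockBody v hk

theorem runs_resetOuter_blockInv :
    Runs ω resetOuter 10 (PhaseInv n η N ω n)
      (BlockInv n η N (phaseState m n fun k => 2 * Real.pi * (ω k : ℝ)) 0) := by
  rintro st ⟨hintact, hcount, -, hused, hamp⟩
  refine ⟨_, ?_, _, .setN _ _ _ _, hintact.writeN (by norm_num) _ _, fun i => by simp [hcount],
    by simp [NExp.eval], hused, fun i => ?_⟩
  · simp [NExp.cost]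
  · rw [amp_writeN, hamp, List.take_zero, Network.elements, List.flatMap_nil, transfer,
      Matrix.one_mulVec, phaseState]
    split_ifs <;> rfl

end BlockLoop

/-- Sum of the weights of the modes below `j`: the left end of the detection interval of `j`. -/
def cumul {m : ℕ} (c : Fin m → ℝ) (j : ℕ) : ℝ := ∑ i with i.1 < j, c i

theorem cumul_zero {m : ℕ} (c : Fin m → ℝ) : cumul c 0 = 0 := by
  simp [cumul]

theorem cumul_succ {m : ℕ} (c : Fin m → ℝ) {j : ℕ} (hj : j < m) :
    cumul c (j + 1) = cumul c j + c ⟨j, hj⟩ := by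
  have hinsert : (Finset.univ.filter fun i : Fin m => i.1 < j + 1) =
      insert ⟨j, hj⟩ (Finset.univ.filter fun i : Fin m => i.1 < j) := by
    ext i
    simp only [Finset.mem_filter, Finset.mem_univ, true_and, Finset.mem_insert, Fin.ext_iff]
    omega
  rw [cumul, hinsert, Finset.sum_insert (by simp), add_comm, cumul]

/-- The detection interval of mode `j`: its length is the weight `c j`. -/
abbrev cell {m : ℕ} (c : Fin m → ℝ) (j : ℕ) : Set ℝ := Set.Ico (cumul c j) (cumul c (j + 1))

/-- The number of the first `n` terms of `u` that lie in the detection interval of mode `j`. -/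
def detections {m : ℕ} (c : Fin m → ℝ) (u : ℕ → ℝ) (n : ℕ) (j : Fin m) : ℕ :=
  ((Finset.range n).filter fun k => u k ∈ cell c j).card

theorem detections_succ {m : ℕ} (c : Fin m → ℝ) (u : ℕ → ℝ) (n : ℕ) (j : Fin m) :
    detections c u (n + 1) j = detections c u n j + if u n ∈ cell c j then 1 else 0 := by
  rw [detections, Finset.range_add_one, Finset.filter_insert]
  split_ifs
  · rw [Finset.card_insert_of_notMem (by simp), detections]
  · rfl

section PhotonLoop

variable {m n : ℕ} {η : ℝ} {N : Network m} {ω : ℕ → unitInterval} {w : Fin m → ℂ} {k : ℕ}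

/-- Invariant of the detection loop for photon `k` with random number `u`: the modes below `j` have
been compared with it, starting from the counts `base`. -/
structure DetectInv {m : ℕ} (n : ℕ) (η : ℝ) (N : Network m) (w : Fin m → ℂ) (k : ℕ) (u : ℝ)
    (base : Fin m → ℕ) (j : ℕ) (st : Store) : Prop where
  intact : Intact n η N st
  outer_eq : st.nat 4 0 = k
  inner_eq : st.nat 4 1 = j
  used_eq : st.used = n + k + 1
  amp_eq : ∀ i : Fin m, amp st i = w i
  random_eq : st.real 11 0 = u
  cumul_eq : st.real 11 1 = cumul (fun i => Complex.normSq (w i)) j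
  count_eq : ∀ i : Fin m, st.nat 3 i =
    base i + if i.1 < j ∧ u ∈ cell (fun i => Complex.normSq (w i)) i then 1 else 0

theorem exec_detectTest (st : Store) :
    ∃ t ≤ 30, Exec ω detectTest st t (st.writeN 3 (st.nat 4 1) (st.nat 3 (st.nat 4 1) +
      if st.real 11 0 ∈ Set.Ico (st.real 11 1) (st.real 11 2) then 1 else 0)) := by
  by_cases hlower : st.real 11 1 ≤ st.real 11 0
  · by_cases hupper : st.real 11 0 < st.real 11 2
    · rw [if_pos ⟨hlower, hupper⟩]
      exact ⟨_, by simp [Test.cost, RExp.cost, NExp.cost], .iteFalse hlower.not_gt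
        (.iteTrue hupper (.setN _ _ _ _))⟩
    · rw [if_neg fun h => hupper h.2, add_zero, Store.writeN_self]
      exact ⟨_, by simp [Test.cost, RExp.cost, NExp.cost], .iteFalse hlower.not_gt
        (.iteFalse hupper (.skip _))⟩
  · rw [if_neg fun h => hlower h.1, add_zero, Store.writeN_self]
    exact ⟨_, by simp [Test.cost, RExp.cost, NExp.cost], .iteTrue (not_le.1 hlower) (.skip _)⟩

theorem nextCumul_eval {u : ℝ} {base : Fin m → ℕ} {j : ℕ} {st : Store}
    (h : DetectInv n η N w k u base j st) (hj : j < m) :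
    nextCumul.eval st = cumul (fun i => Complex.normSq (w i)) (j + 1) := by
  rw [cumul_succ _ hj, ← h.amp_eq, ← h.cumul_eq, Complex.normSq_apply]
  simp only [nextCumul, RExp.eval, NExp.eval, h.inner_eq, amp]

theorem runs_detectBody (u : ℝ) (base : Fin m → ℕ) {j : ℕ} (hj : j < m) :
    Runs ω detectBody 70 (DetectInv n η N w k u base j) (DetectInv n η N w k u base (j + 1)) := by
  intro st h
  have hnext := nextCumul_eval h hj
  obtain ⟨hintact, houter, hinner, hused, hamp, hrandom, hcumul, hcount⟩ := h
  obtain ⟨t, ht, htest⟩ := exec_detectTest (ω := ω) (st.writeR 11 2 (nextCumul.eval st))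
  refine ⟨_, ?_, _, .seq (.setR _ _ _ _) (.seq htest (.seq (.setR _ _ _ _) (.setN _ _ _ _))),
    ?_, ?_, ?_, ?_, fun i => ?_, ?_, ?_, fun i => ?_⟩
  · simp only [RExp.cost, NExp.cost, nextCumul]
    omega
  · exact (((hintact.writeR (by norm_num) _ _).writeN (by norm_num) _ _).writeR
      (by norm_num) _ _).writeN (by norm_num) _ _
  · simp [NExp.eval, houter]
  · simp [NExp.eval, hinner]
  · exact hused
  · simp [amp_writeN, amp_writeR, hamp]
  · simp [NExp.eval, hrandom]
  · simp [NExp.eval, RExp.eval, hnext]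
  · simp only [NExp.eval, Store.nat_writeN, Store.nat_writeR, Store.real_writeR, hinner, hrandom,
      hcumul, hnext, hcount]
    rcases eq_or_ne i.1 j with rfl | hij
    · simp [hcount]
    · have hlt : i.1 < j + 1 ↔ i.1 < j := by omega
      simp [hij, hlt]

/-- Invariant of the third loop: the first `k` photons have been detected. -/
structure PhotonInv {m : ℕ} (n : ℕ) (η : ℝ) (N : Network m) (w : Fin m → ℂ)
    (ω : ℕ → unitInterval) (k : ℕ) (st : Store) : Prop where
  intact : Intact n η N st
  outer_eq : st.nat 4 0 = k
  used_eq : st.used = n + k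
  amp_eq : ∀ i : Fin m, amp st i = w i
  count_eq : ∀ i : Fin m, st.nat 3 i =
    detections (fun i => Complex.normSq (w i)) (fun k => (ω (n + k) : ℝ)) k i

theorem runs_drawPhoton :
    Runs ω drawPhoton 20 (PhotonInv n η N w ω k) (DetectInv n η N w k (ω (n + k))
      (detections (fun i => Complex.normSq (w i)) (fun k => (ω (n + k) : ℝ)) k) 0) := by
  rintro st ⟨hintact, houter, hused, hamp, hcount⟩
  refine ⟨_, ?_, _, .seq (.uniform _ _ _) (.seq (.setN _ _ _ _) (.setR _ _ _ _)),
    ?_, ?_, ?_, ?_, fun i => ?_, ?_, ?_, fun i => ?_⟩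
  · simp [RExp.cost, NExp.cost]
  · exact ((hintact.writeR (by norm_num) _ _).tick.writeN (by norm_num) _ _).writeR
      (by norm_num) _ _
  · simp [NExp.eval, houter]
  · simp [NExp.eval]
  · simp [hused]
  · simp [amp_writeN, amp_tick, amp_writeR, hamp]
  · simp [NExp.eval, hused]
  · simp [NExp.eval, RExp.eval, cumul_zero]
  · simp [NExp.eval, hcount]

theorem runs_nextOuter_photonInv :
    Runs ω nextOuter 20 (DetectInv n η N w k (ω (n + k))
      (detections (fun i => Complex.normSq (w i)) (fun k => (ω (n + k) : ℝ)) k) m)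
      (PhotonInv n η N w ω (k + 1)) := by
  rintro st ⟨hintact, houter, -, hused, hamp, -, -, hcount⟩
  refine ⟨_, ?_, _, .setN _ _ _ _, hintact.writeN (by norm_num) _ _, ?_, hused, fun i => ?_,
    fun i => ?_⟩
  · simp [NExp.cost]
  · simp [NExp.eval, houter]
  · rw [amp_writeN, hamp]
  · simp [NExp.eval, hcount, detections_succ]

theorem runs_photonBody :
    Runs ω photonBody (20 + ((m * (5 + 70) + 5) + 20)) (PhotonInv n η N w ω k)
      (PhotonInv n η N w ω (k + 1)) :=
  runs_drawPhoton.seq <| Runs.seq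
    (Runs.loop _ (fun _ _ h => by simp [Test.holds, NExp.eval, h.inner_eq, h.intact.modes])
      fun _ hj => runs_detectBody _ _ hj)
    runs_nextOuter_photonInv

theorem runs_photonLoop :
    Runs ω (.loop (.ltN outer photons) photonBody)
      (n * (5 + (20 + ((m * (5 + 70) + 5) + 20))) + 5) (PhotonInv n η N w ω 0)
      (PhotonInv n η N w ω n) :=
  Runs.loop _ (fun _ _ h => by simp [Test.holds, NExp.eval, h.outer_eq, h.intact.photons])
    fun _ _ => runs_photonBody

theorem runs_resetOuter_photonInv (v : Fin m → ℂ) :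
    Runs ω resetOuter 10 (BlockInv n η N v N.length)
      (PhotonInv n η N (transfer η N.elements *ᵥ v) ω 0) := by
  rintro st ⟨hintact, hcount, -, hused, hamp⟩
  refine ⟨_, ?_, _, .setN _ _ _ _, hintact.writeN (by norm_num) _ _, ?_, hused, fun i => ?_,
    fun i => ?_⟩
  · simp [NExp.cost]
  · simp [NExp.eval]
  · rw [amp_writeN, hamp, List.take_length]
  · simp [hcount, detections]

end PhotonLoop

section Program

variable {m : ℕ}

/-- The probabilities with which a photon of single-particle state `v_φ` is detected in the modes
behind the network. -/
def weights (n : ℕ) (η : ℝ) (N : Network m) (φ : Fin n → ℝ) (i : Fin m) : ℝ :=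
  Complex.normSq ((transfer η N.elements *ᵥ phaseState m n φ) i)

/-- The counts left by `program` when it reads the random numbers `ω`. -/
def programCounts (n : ℕ) (η : ℝ) (N : Network m) (ω : ℕ → unitInterval) : Fin m → ℕ :=
  detections (weights n η N fun k => 2 * Real.pi * (ω k : ℝ)) (fun k => (ω (n + k) : ℝ)) n

/-- A polynomial bound on the number of steps of `program`. -/
def stepBound : Polynomial ℕ := Polynomial.C 1000 * (Polynomial.X + 1) ^ 2

theorem exists_exec_program (n : ℕ) (η : ℝ) (N : Network m) (ω : ℕ → unitInterval) :
    ∃ t ≤ stepBound.eval (m + n + N.length), ∃ st', Exec ω program (inputStore n η N) t st' ∧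
      ∀ j : Fin m, st'.nat 3 j = programCounts n η N ω j := by
  obtain ⟨t, ht, st', hexec, hinv⟩ := (runs_phaseLoop.seq <| runs_resetOuter_blockInv.seq <|
    (runs_blockLoop _).seq <| (runs_resetOuter_photonInv _).seq runs_photonLoop)
    (inputStore n η N) (phaseInv_inputStore (ω := ω))
  refine ⟨t, ht.trans ?_, st', hexec, hinv.count_eq⟩
  simp only [stepBound, Polynomial.eval_mul, Polynomial.eval_C, Polynomial.eval_pow,
    Polynomial.eval_add, Polynomial.eval_X, Polynomial.eval_one]
  nlinarith [Nat.zero_le (m * n), Nat.zero_le (m * N.length), Nat.zero_le (n * N.length),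
    Nat.zero_le (m ^ 2), Nat.zero_le (n ^ 2), Nat.zero_le (N.length ^ 2)]

end Program

end Sampler

/-! ## Multinomial counts -/

section LabelCounts

variable {m n : ℕ}

/-- The number of particles found in each mode, when `f` assigns to each of `n` particles the mode
in which it is found, or `none` if it is lost. -/
def labelCounts (f : Fin n → Option (Fin m)) (j : Fin m) : ℕ :=
  (Finset.univ.filter fun k => f k = some j).card

theorem sum_labelCounts_le (f : Fin n → Option (Fin m)) : ∑ j, labelCounts f j ≤ n := by
  have h := Finset.card_eq_sum_card_fiberwise (s := Finset.univ) (t := Finset.univ) (f := f)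
    (by simp)
  rw [Finset.card_univ, Fintype.card_fin, Fintype.sum_option] at h
  exact (Nat.le_add_left _ _).trans_eq h.symm

theorem coeff_C_add_creation_pow (c : ℂ) (v : Fin m → ℂ) {p : Fin m → ℕ} (hp : ∑ i, p i ≤ n) :
    ((MvPolynomial.C c + creation v) ^ n).coeff (Finsupp.equivFunOnFinite.symm p) =
      n.factorial / ((n - ∑ i, p i).factorial * occFactorial p) *
        ((∏ i, v i ^ p i) * c ^ (n - ∑ i, p i)) := by
  have coeff_term (k : ℕ) : (creation v ^ k * MvPolynomial.C c ^ (n - k) *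
      (n.choose k : MvPolynomial (Fin m) ℂ)).coeff (Finsupp.equivFunOnFinite.symm p) =
      c ^ (n - k) * n.choose k *
        if ∑ i, p i = k then (k.factorial / occFactorial p : ℂ) * ∏ i, v i ^ p i else 0 := by
    rw [← coeff_creation_pow, ← MvPolynomial.coeff_C_mul]
    simp only [map_mul, map_pow, map_natCast]
    ring_nf
  rw [add_comm, add_pow, MvPolynomial.coeff_sum,
    Finset.sum_congr rfl fun k _ => coeff_term k, Finset.sum_eq_single (∑ i, p i)]
  · rw [if_pos rfl, Nat.cast_choose ℂ hp]
    have : ((∑ i, p i).factorial : ℂ) ≠ 0 := Nat.cast_ne_zero.2 (Nat.factorial_ne_zero _)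
    field_simp
  · intro k _ hk
    rw [if_neg hk.symm, mul_zero]
  · intro h
    exact absurd (Finset.mem_range.2 (Nat.lt_succ_of_le hp)) h

theorem prod_option_elim_one_X (f : Fin n → Option (Fin m)) :
    ∏ k, (f k).elim 1 MvPolynomial.X =
      MvPolynomial.monomial (R := ℂ) (Finsupp.equivFunOnFinite.symm (labelCounts f)) 1 := by
  rw [MvPolynomial.monomial_eq, Finsupp.prod_fintype _ _ (by simp), map_one, one_mul,
    ← Finset.prod_fiberwise Finset.univ f, Fintype.prod_option, Finset.prod_eq_one, one_mul]
  · refine Finset.prod_congr rfl fun j _ => Finset.prod_eq_pow_card fun k hk => ?_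
    rw [(Finset.mem_filter.1 hk).2, Option.elim_some]
  · intro k hk
    rw [(Finset.mem_filter.1 hk).2, Option.elim_none]

theorem sum_prod_labelCounts (q : Option (Fin m) → ℂ) {p : Fin m → ℕ} (hp : ∑ i, p i ≤ n) :
    ∑ f : Fin n → Option (Fin m) with labelCounts f = p, ∏ k, q (f k) =
      n.factorial / ((n - ∑ i, p i).factorial * occFactorial p) *
        ((∏ j, q (some j) ^ p j) * q none ^ (n - ∑ i, p i)) := by
  have sum_labels : MvPolynomial.C (q none) + creation (fun j => q (some j)) =
      ∑ o, MvPolynomial.C (q o) * o.elim 1 MvPolynomial.X := by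
    simp [creation]
  rw [← coeff_C_add_creation_pow _ (fun j => q (some j)) hp, sum_labels, Fintype.sum_pow,
    MvPolynomial.coeff_sum, Finset.sum_filter]
  refine Finset.sum_congr rfl fun f _ => ?_
  rw [Finset.prod_mul_distrib, prod_option_elim_one_X, ← map_prod, MvPolynomial.coeff_C_mul,
    MvPolynomial.coeff_monomial]
  simp only [EmbeddingLike.apply_eq_iff_eq, mul_ite, mul_one, mul_zero]

variable {α : Type*}

theorem setOf_labelCounts_eq (ℓ : α → Fin n → Option (Fin m)) (p : Fin m → ℕ) :
    {x | labelCounts (ℓ x) = p} =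
      ⋃ f ∈ Finset.univ.filter fun f : Fin n → Option (Fin m) => labelCounts f = p,
        {x | ℓ x = f} := by
  ext x
  simp

variable [MeasurableSpace α]

theorem measurableSet_labelCounts_eq {ℓ : α → Fin n → Option (Fin m)}
    (hℓ : ∀ k o, MeasurableSet {x | ℓ x k = o}) (p : Fin m → ℕ) :
    MeasurableSet {x | labelCounts (ℓ x) = p} := by
  rw [setOf_labelCounts_eq]
  refine Finset.measurableSet_biUnion _ fun f _ => ?_
  simp only [funext_iff, Set.ofPred_forall]
  exact MeasurableSet.iInter fun k => hℓ k _

variable (μ : Measure α) [IsProbabilityMeasure μ]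

theorem measureReal_label_eq_none {ℓ : α → Option (Fin m)}
    (hℓ : ∀ o, MeasurableSet (ℓ ⁻¹' {o})) :
    μ.real (ℓ ⁻¹' {none}) = 1 - ∑ j, μ.real (ℓ ⁻¹' {some j}) := by
  have h := sum_measureReal_preimage_singleton (μ := μ) Finset.univ fun o _ => hℓ o
  rw [Finset.coe_univ, Set.preimage_univ, probReal_univ, Fintype.sum_option] at h
  linarith

theorem measureReal_labelCounts_eq {ℓ : α → Option (Fin m)}
    (hℓ : ∀ o, MeasurableSet (ℓ ⁻¹' {o})) {p : Fin m → ℕ} (hp : ∑ i, p i ≤ n) :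
    (Measure.pi fun _ : Fin n => μ).real {x | labelCounts (fun k => ℓ (x k)) = p} =
      multinomialProb n (fun j => μ.real (ℓ ⁻¹' {some j})) p := by
  have setOf_eq_pi (f : Fin n → Option (Fin m)) :
      {x : Fin n → α | (fun k => ℓ (x k)) = f} = Set.univ.pi fun k => ℓ ⁻¹' {f k} := by
    ext x
    simp [funext_iff]
  have h := sum_prod_labelCounts (fun o => (μ.real (ℓ ⁻¹' {o}) : ℂ)) hp
  rw [measureReal_label_eq_none μ hℓ] at h
  rw [setOf_labelCounts_eq, measureReal_biUnion_finset, multinomialProb]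
  · simp only [setOf_eq_pi, Measure.real, Measure.pi_pi, ENNReal.toReal_prod]
    simp only [← measureReal_def]
    apply Complex.ofReal_injective
    push_cast at h ⊢
    exact h
  · intro f _ f' _ hne
    exact Set.disjoint_left.2 fun x hx hx' => hne (hx.symm.trans hx')
  · intro f _
    rw [setOf_eq_pi]
    exact MeasurableSet.univ_pi fun k => hℓ _

end LabelCounts

namespace Sampler

/-! ## The output distribution of the sampling program -/

section Detection

variable {m : ℕ} {c : Fin m → ℝ}

theorem cumul_mono (hc : ∀ i, 0 ≤ c i) : Monotone (cumul c) := fun _ _ hab =>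
  Finset.sum_le_sum_of_subset_of_nonneg
    (Finset.monotone_filter_right _ fun _ _ h => h.trans_le hab) fun i _ _ => hc i

theorem cumul_le_sum (hc : ∀ i, 0 ≤ c i) (j : ℕ) : cumul c j ≤ ∑ i, c i :=
  Finset.sum_le_sum_of_subset_of_nonneg (Finset.filter_subset _ _) fun i _ _ => hc i

open Classical in
/-- The mode whose detection interval contains `x`. -/
def detected (c : Fin m → ℝ) (x : ℝ) : Option (Fin m) :=
  if h : ∃ j : Fin m, x ∈ cell c j then some h.choose else none

theorem detected_eq_some_iff (hc : ∀ i, 0 ≤ c i) {x : ℝ} {j : Fin m} :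
    detected c x = some j ↔ x ∈ cell c j := by
  unfold detected
  split_ifs with h
  · rw [Option.some.injEq]
    refine ⟨fun hj => hj ▸ h.choose_spec, fun hx => by_contra fun hne => ?_⟩
    exact Set.disjoint_left.1 ((cumul_mono hc).pairwise_disjoint_on_Ico_succ
      (Fin.val_injective.ne hne)) h.choose_spec hx
  · exact ⟨nofun, fun hx => absurd ⟨j, hx⟩ h⟩

theorem detections_eq_labelCounts (hc : ∀ i, 0 ≤ c i) (u : ℕ → ℝ) (n : ℕ) :
    detections c u n = labelCounts fun k : Fin n => detected c (u k) := by
  funext j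
  simp only [detections, labelCounts, detected_eq_some_iff hc]
  rw [Finset.card_filter, Finset.card_filter, Finset.sum_range]

theorem measurableSet_detected_eq {α : Type*} [MeasurableSpace α] {c : α → Fin m → ℝ}
    (hc : ∀ x i, 0 ≤ c x i) (hcm : ∀ i, Measurable fun x => c x i) {u : α → ℝ}
    (hu : Measurable u) (o : Option (Fin m)) : MeasurableSet {x | detected (c x) (u x) = o} := by
  have measurable_cumul (j : ℕ) : Measurable fun x => cumul (c x) j :=
    Finset.measurable_sum _ fun i _ => hcm i
  have measurableSet_some (j : Fin m) : MeasurableSet {x | detected (c x) (u x) = some j} := by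
    simp only [detected_eq_some_iff (hc _)]
    exact (measurableSet_le (measurable_cumul _) hu).inter
      (measurableSet_lt hu (measurable_cumul _))
  cases o with
  | some j => exact measurableSet_some j
  | none =>
    simp only [Option.eq_none_iff_forall_ne_some, Set.ofPred_forall]
    exact MeasurableSet.iInter fun j => (measurableSet_some j).compl

theorem volume_detected_eq_some (hc : ∀ i, 0 ≤ c i) (hc1 : ∑ i, c i ≤ 1) (j : Fin m) :
    (volume : Measure unitInterval).real
      ((fun x : unitInterval => detected c x) ⁻¹' {some j}) = c j := by
  have preimage_eq :
      (fun x : unitInterval => detected c x) ⁻¹' {some j} = Subtype.val ⁻¹' cell c j := by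
    ext x
    exact detected_eq_some_iff hc
  have cell_subset : cell c j ⊆ unitInterval := fun x hx =>
    ⟨((cumul_zero c).symm.trans_le (cumul_mono hc (Nat.zero_le _))).trans hx.1,
      hx.2.le.trans ((cumul_le_sum hc _).trans hc1)⟩
  rw [preimage_eq, Measure.real, unitInterval.measurePreserving_coe.measure_preimage
    measurableSet_Ico.nullMeasurableSet, Measure.restrict_apply measurableSet_Ico,
    Set.inter_eq_left.2 cell_subset, Real.volume_Ico, cumul_succ _ j.2, add_sub_cancel_left,
    ENNReal.toReal_ofReal (hc j)]

theorem measureReal_labelCounts_detected {n : ℕ} (hc : ∀ i, 0 ≤ c i) (hc1 : ∑ i, c i ≤ 1)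
    {p : Fin m → ℕ} (hp : ∑ i, p i ≤ n) :
    (Measure.pi fun _ : Fin n => (volume : Measure unitInterval)).real
      {x | labelCounts (fun k => detected c (x k)) = p} = multinomialProb n c p := by
  rw [measureReal_labelCounts_eq volume (ℓ := fun x : unitInterval => detected c x)
    (measurableSet_detected_eq (fun _ => hc) (fun _ => measurable_const)
      measurable_subtype_coe) hp]
  simp only [volume_detected_eq_some hc hc1]

end Detection

section Output

variable {m n : ℕ} {η : ℝ}

/-- The random numbers read by `program`: the phases of the single-particle state and the numbers
that decide where the photons are detected. -/
def splitTape (n : ℕ) (ω : ℕ → unitInterval) : (Fin n → ℝ) × (Fin n → unitInterval) :=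
  (fun k => 2 * Real.pi * (ω k : ℝ), fun k => ω (n + k))

theorem measurePreserving_splitTape (n : ℕ) :
    MeasurePreserving (splitTape n) tapeLaw
      ((phaseLaw n).prod (Measure.pi fun _ : Fin n => volume)) := by
  let index : Fin n ⊕ Fin n → ℕ := Sum.elim (fun k => k) fun k => n + k
  have index_injective : Function.Injective index :=
    Fin.val_injective.sumElim ((add_right_injective n).comp Fin.val_injective)
      fun a b => (a.2.trans_le (Nat.le_add_right n b)).ne
  have select : MeasurePreserving (fun (ω : ℕ → unitInterval) i => ω (index i)) tapeLaw
      (Measure.pi fun _ => volume) :=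
    ⟨by fun_prop, (Measure.map_infinitePi_infinitePi_of_inj index_injective).trans
      (Measure.infinitePi_eq_pi _)⟩
  have phases : MeasurePreserving (fun (θ : Fin n → unitInterval) k => 2 * Real.pi * (θ k : ℝ))
      (Measure.pi fun _ => volume) (phaseLaw n) :=
    ⟨by fun_prop, Measure.pi_map_pi (μ := fun _ => (volume : Measure unitInterval))
      (f := fun _ (x : unitInterval) => 2 * Real.pi * (x : ℝ))
      (hμ := fun _ => inferInstanceAs (SigmaFinite angleLaw)) fun _ => by fun_prop⟩
  exact (phases.prod (.id _)).comp ((measurePreserving_sumPiEquivProdPi _).comp select)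

theorem ofReal_sum_normSq (v : Fin m → ℂ) :
    ((∑ i, Complex.normSq (v i) : ℝ) : ℂ) = v ⬝ᵥ star v := by
  simp [dotProduct, Complex.mul_conj]

theorem sum_normSq_element_transfer_le (h0 : 0 ≤ η) (h1 : η ≤ 1) (e : Element m)
    (v : Fin m → ℂ) :
    ∑ i, Complex.normSq ((e.transfer η *ᵥ v) i) ≤ ∑ i, Complex.normSq (v i) := by
  cases e with
  | loss i =>
    have h := lossMatrix_mulVec_dotProduct_star_lossMatrix_mulVec h0 i v v
    rw [← ofReal_sum_normSq, ← ofReal_sum_normSq, mul_assoc, Complex.mul_conj] at h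
    have lost_nonneg := mul_nonneg (sub_nonneg.2 h1) (Complex.normSq_nonneg (v i))
    exact (by exact_mod_cast h : _ = _ - (1 - η) * Complex.normSq (v i)).trans_le
      (sub_le_self _ lost_nonneg)
  | bs g =>
    have h := g.matrix_mulVec_dotProduct_star_matrix_mulVec (v := v) (w := v)
    rw [← ofReal_sum_normSq, ← ofReal_sum_normSq] at h
    exact (Complex.ofReal_injective h).le

theorem sum_normSq_transfer_le (h0 : 0 ≤ η) (h1 : η ≤ 1) (L : List (Element m))
    (v : Fin m → ℂ) :
    ∑ i, Complex.normSq ((transfer η L *ᵥ v) i) ≤ ∑ i, Complex.normSq (v i) := by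
  induction L generalizing v with
  | nil => simp [transfer]
  | cons e L ih =>
    rw [transfer, ← Matrix.mulVec_mulVec]
    exact (ih _).trans (sum_normSq_element_transfer_le h0 h1 e v)

theorem weights_nonneg (N : Network m) (φ : Fin n → ℝ) (i : Fin m) : 0 ≤ weights n η N φ i :=
  Complex.normSq_nonneg _

theorem sum_weights_le_one (hnm : n ≤ m) (h0 : 0 ≤ η) (h1 : η ≤ 1) (N : Network m)
    (φ : Fin n → ℝ) : ∑ i, weights n η N φ i ≤ 1 := by
  refine (sum_normSq_transfer_le h0 h1 N.elements (phaseState m n φ)).trans ?_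
  rcases eq_or_ne n 0 with rfl | hn
  · simp [phaseState]
  · have h := phaseState_dotProduct_star hnm hn φ
    rw [← ofReal_sum_normSq] at h
    exact (by exact_mod_cast h : _ = (1 : ℝ)).le

theorem measurable_weights (N : Network m) (i : Fin m) :
    Measurable fun φ : Fin n → ℝ => weights n η N φ i := by
  have continuous_amplitudes : Continuous fun φ : Fin n → ℝ =>
      transfer η N.elements *ᵥ phaseState m n φ :=
    continuous_const.matrix_mulVec (continuous_pi continuous_phaseState)
  exact (Complex.continuous_normSq.comp
    ((continuous_apply i).comp continuous_amplitudes)).measurable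

/-- The event that the `n` photons, detected with the random numbers `x.2` behind a network that
carries the single-particle state of phases `x.1`, leave the counts `p`. -/
def countEvent (n : ℕ) (η : ℝ) (N : Network m) (p : Fin m → ℕ) :
    Set ((Fin n → ℝ) × (Fin n → unitInterval)) :=
  {x | labelCounts (fun k => detected (weights n η N x.1) (x.2 k)) = p}

theorem measurableSet_countEvent (N : Network m) (p : Fin m → ℕ) :
    MeasurableSet (countEvent n η N p) := by
  refine measurableSet_labelCounts_eq (fun k o => ?_) p
  exact measurableSet_detected_eq
    (c := fun x : (Fin n → ℝ) × (Fin n → unitInterval) => weights n η N x.1)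
    (u := fun x => (x.2 k : ℝ)) (fun x => weights_nonneg N x.1)
    (fun i => (measurable_weights N i).comp measurable_fst) (by fun_prop) o

theorem measureReal_countEvent (hnm : n ≤ m) (h0 : 0 ≤ η) (h1 : η ≤ 1) (N : Network m)
    (p : Fock m n) :
    ((phaseLaw n).prod (Measure.pi fun _ : Fin n => (volume : Measure unitInterval))).real
      (countEvent n η N p.1) = outputDist (channel n η N.elements (sepState m n n)) p := by
  have hmeas := measurableSet_countEvent (n := n) (η := η) N p.1
  rw [outputDist_channel_sepState hnm h0 h1, Measure.real, Measure.prod_apply hmeas,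
    ← integral_toReal (measurable_measure_prodMk_left hmeas).aemeasurable
      (Filter.Eventually.of_forall fun φ => measure_lt_top _ _)]
  exact integral_congr_ae (Filter.Eventually.of_forall fun φ =>
    measureReal_labelCounts_detected (weights_nonneg N φ) (sum_weights_le_one hnm h0 h1 N φ) p.2)

theorem programCounts_eq_labelCounts (N : Network m) (ω : ℕ → unitInterval) :
    programCounts n η N ω = labelCounts fun k : Fin n =>
      detected (weights n η N fun k => 2 * Real.pi * (ω k : ℝ)) (ω (n + k)) :=
  detections_eq_labelCounts (weights_nonneg N _) _ _

theorem sum_programCounts_le (N : Network m) (ω : ℕ → unitInterval) :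
    ∑ j, programCounts n η N ω j ≤ n := by
  rw [programCounts_eq_labelCounts]
  exact sum_labelCounts_le _

theorem samplesWithin_program (hnm : n ≤ m) (h0 : 0 ≤ η) (h1 : η ≤ 1) (N : Network m) :
    SamplesWithin program (inputStore n η N) (stepBound.eval (m + n + N.length))
      (outputDist (channel n η N.elements (sepState m n n))) := by
  refine ⟨fun ω => ⟨programCounts n η N ω, sum_programCounts_le N ω⟩,
    exists_exec_program n η N, fun p => ?_⟩
  have preimage_eq : (fun ω => (⟨programCounts n η N ω, sum_programCounts_le N ω⟩ : Fock m n)) ⁻¹'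
      {p} = splitTape n ⁻¹' countEvent n η N p.1 := by
    ext ω
    simp only [Set.mem_preimage, Set.mem_singleton_iff, Subtype.ext_iff,
      programCounts_eq_labelCounts]
    rfl
  have measurableSet_event := measurableSet_countEvent (n := n) (η := η) N p.1
  rw [preimage_eq, (measurePreserving_splitTape n).measureReal_preimage
    measurableSet_event.nullMeasurableSet, measureReal_countEvent hnm h0 h1]
  exact ⟨(measurePreserving_splitTape n).measurable measurableSet_event, rfl⟩

end Output

end Sampler

/-! ## Weak approximation -/

theorem Network.exists_sampleable_approximation {m : ℕ} {η : ℝ} (h0 : 0 ≤ η) (h1 : η ≤ 1)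
    (N : Network m) :
    ∃ N' : List (Element m),
      beamsplitters N' = N ∧
      lossCount N' + minDepth N * m = lossCount N.elements ∧
      (∀ (K : ℕ) (ρ : Op m K),
        channel K η N.elements ρ = channel K η N' (uniformLoss K (η ^ minDepth N) ρ)) ∧
      ∀ n : ℕ, n ≤ m →
        SamplesWithin Sampler.program (inputStore n η N)
          (Sampler.stepBound.eval (m + n + N.length))
          (outputDist (channel n η N' (sepMixture m n (η ^ minDepth N)))) ∧
        tvDist (outputDist (channel n η N.elements (inputState m n)))
          (outputDist (channel n η N' (sepMixture m n (η ^ minDepth N)))) ≤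
            sepDist m n (η ^ minDepth N) := by
  have ht0 : 0 ≤ η ^ minDepth N := pow_nonneg h0 _
  have ht1 : η ^ minDepth N ≤ 1 := pow_le_one₀ h0 h1
  obtain ⟨L, hbeamsplitters, hlosses, htransfer⟩ := Network.exists_uniform_losses h0 N
  have hchannel (K : ℕ) (ρ : Op m K) :
      channel K η N.elements ρ = channel K η L (uniformLoss K (η ^ minDepth N) ρ) :=
    channel_eq_of_transfer_eq h0 h1 ht0 ht1 htransfer ρ
  refine ⟨L, hbeamsplitters, hlosses, hchannel, fun n hnm => ⟨?_, ?_⟩⟩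
  · rw [← uniformLoss_sepState hnm ht0 ht1, ← hchannel]
    exact Sampler.samplesWithin_program hnm h0 h1 N
  · rw [hchannel]
    exact tvDist_channel_le_sepDist hnm h0 h1 ht0 ht1 L

theorem pow_le_inv_of_log_le {η x : ℝ} (h0 : 0 ≤ η) (h1 : η < 1) (hx : 0 < x) {s : ℕ}
    (h : (1 - η)⁻¹ * Real.log x ≤ s) : η ^ s ≤ x⁻¹ := by
  rw [inv_mul_le_iff₀ (sub_pos.2 h1)] at h
  calc η ^ s ≤ Real.exp (η - 1) ^ s :=
        pow_le_pow_left₀ h0 (by linarith [Real.add_one_le_exp (η - 1)]) s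
    _ = Real.exp (s * (η - 1)) := (Real.exp_nat_mul _ _).symm
    _ ≤ Real.exp (-Real.log x) := Real.exp_le_exp.2 (by linarith)
    _ = x⁻¹ := by rw [Real.exp_neg, Real.exp_log hx]

theorem sepDist_le_inv {m n : ℕ} (hnm : n ≤ m) (hn : n ≠ 0) {t : ℝ} (h0 : 0 ≤ t)
    (ht : t ≤ (n : ℝ)⁻¹) : sepDist m n t ≤ (n : ℝ)⁻¹ := by
  have htn : t * n ≤ 1 := (le_inv_mul_iff₀' (by positivity)).1 (by simpa using ht)
  have h1 : t ≤ 1 := ht.trans (Nat.cast_inv_le_one n)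
  calc sepDist m n t ≤ t ^ 2 * n / 2 + t * (1 - t) / 2 := sepDist_le hnm h0 h1
    _ ≤ t := by nlinarith [mul_le_mul_of_nonneg_left htn h0, mul_nonneg h0 h0]
    _ ≤ (n : ℝ)⁻¹ := ht

theorem exists_forall_sepDist_pow_le {η : ℝ} (h0 : 0 ≤ η) (h1 : η < 1) {ε : ℝ} (hε : 0 < ε) :
    ∃ n₀ : ℕ, ∀ n ≥ n₀, ∀ m ≥ n, ∀ s : ℕ, (1 - η)⁻¹ * Real.log n ≤ s →
      sepDist m n (η ^ s) ≤ ε := by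
  obtain ⟨n₀, hn₀⟩ := exists_nat_gt ε⁻¹
  refine ⟨n₀, fun n hn m hnm s hs => ?_⟩
  have hεn : ε⁻¹ < n := hn₀.trans_le (Nat.cast_le.2 hn)
  have hn_pos : (0 : ℝ) < n := (inv_pos.2 hε).trans hεn
  calc sepDist m n (η ^ s) ≤ (n : ℝ)⁻¹ :=
        sepDist_le_inv hnm (Nat.cast_pos.1 hn_pos).ne' (pow_nonneg h0 s)
          (pow_le_inv_of_log_le h0 h1 hn_pos hs)
    _ ≤ ε := inv_le_of_inv_le₀ hε hεn.le

end LossyOptics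

end

theorem mainTheorem3 :
    ∃ (prog : Cmd) (T : Polynomial ℕ),
      (∀ (m : ℕ) (N : Network m) (η : ℝ), 0 ≤ η → η ≤ 1 →
        ∃ N' : List (Element m),
          beamsplitters N' = N ∧
          lossCount N' + minDepth N * m = lossCount N.elements ∧
          (∀ (K : ℕ) (ρ : Op m K),
            channel K η N.elements ρ = channel K η N' (uniformLoss K (η ^ minDepth N) ρ)) ∧
          ∀ n : ℕ, n ≤ m →
            SamplesWithin prog (inputStore n η N) (T.eval (m + n + N.length))
              (outputDist (channel n η N' (sepMixture m n (η ^ minDepth N)))) ∧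
            tvDist (outputDist (channel n η N.elements (inputState m n)))
              (outputDist (channel n η N' (sepMixture m n (η ^ minDepth N)))) ≤
                sepDist m n (η ^ minDepth N) ∧
            sepDist m n (η ^ minDepth N) =
              ∑ l ∈ Finset.range (n + 1),
                (n.choose l : ℝ) * (η ^ minDepth N) ^ l * (1 - η ^ minDepth N) ^ (n - l) *
                  (1 - (n.factorial : ℝ) / ((n : ℝ) ^ l * ((n - l).factorial : ℝ))) ∧
            sepDist m n (η ^ minDepth N) ≤
              (η ^ minDepth N) ^ 2 * n / 2 + η ^ minDepth N * (1 - η ^ minDepth N) / 2) ∧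
      ∀ η : ℝ, 0 ≤ η → η < 1 →
        ∃ C : ℝ, 0 < C ∧ ∀ ε : ℝ, 0 < ε →
          ∃ n₀ : ℕ, ∀ n : ℕ, n₀ ≤ n → ∀ m : ℕ, n ≤ m → ∀ N : Network m,
            C * Real.log n ≤ minDepth N →
              ∃ Q : Fock m n → ℝ,
                SamplesWithin prog (inputStore n η N) (T.eval (m + n + N.length)) Q ∧
                tvDist (outputDist (channel n η N.elements (inputState m n))) Q ≤ ε := by
  refine ⟨Sampler.program, Sampler.stepBound, fun m N η h0 h1 => ?_, fun η h0 h1 => ?_⟩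
  · have ht0 : 0 ≤ η ^ minDepth N := pow_nonneg h0 _
    have ht1 : η ^ minDepth N ≤ 1 := pow_le_one₀ h0 h1
    obtain ⟨N', hbeamsplitters, hlosses, hchannel, h⟩ :=
      Network.exists_sampleable_approximation h0 h1 N
    exact ⟨N', hbeamsplitters, hlosses, hchannel, fun n hnm =>
      ⟨(h n hnm).1, (h n hnm).2, sepDist_eq hnm ht0 ht1, sepDist_le hnm ht0 ht1⟩⟩
  · refine ⟨(1 - η)⁻¹, inv_pos.2 (sub_pos.2 h1), fun ε hε => ?_⟩
    obtain ⟨n₀, hn₀⟩ := exists_forall_sepDist_pow_le h0 h1 hε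
    refine ⟨n₀, fun n hn m hnm N hdepth => ?_⟩
    obtain ⟨N', -, -, -, h⟩ := Network.exists_sampleable_approximation h0 h1.le N
    exact ⟨_, (h n hnm).1, (h n hnm).2.trans (hn₀ n hn m hnm _ hdepth)⟩
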